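/- Consider a $T$-tier downlink cellular network in the plane with a typical terminal at the origin. The base stations of tier $q$, $q=1,\dots,T$, form a homogeneous Poisson point process $\Phi_q$ of density $\lambda_q>0$; they have transmit power $P_q>0$, bias $B_q>0$ and $F_B^{(q)}\ge 1$ (an integer) available frequency bands; all tiers have the same path-loss exponent $\alpha>2$ and the noise power is $\sigma_N^2>0$. Let $d_{q,b}$ be the distance of the $b$-th base station of tier $q$ from the origin and $d_q=\min_b d_{q,b}$. The terminal is associated with the tier $t^*=\arg\max_t P_t d_t^{-\alpha}B_t$ and is served by the nearest base station of that tier. The power gain $g_{t,0}$ of the serving link (when $t^*=t$) and the power gains $g_{q,b}$ of the interfering links are nonnegative with mean $1$; the $g_{q,b}$ are identically distributed within each tier, and the law of $g_{t,0}$ may differ from that of $g_{t,b}$. Random frequency reuse: each interfering base station of tier $q$ picks one of the $F_B^{(q)}$ bands uniformly at random, and interferes only if this is the band of its tier that the serving link occupies (an event of probability $1/F_B^{(q)}$). The point processes, all gains and all band choices are mutually independent. When $t^*=t$, put $$\mathrm{SINR}_t=\frac{P_t\,g_{t,0}\,d_t^{-\alpha}}{\sigma_N^2+I_{\rm agg}},\qquad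 I_{\rm agg}=\sum_{q=1}^T\sum_{b}P_q\,g_{q,b}\,d_{q,b}^{-\alpha},$$ the sum being over the interfering base stations (the serving one excluded), and let $$\tilde{\mathcal R}_t=\mathcal A_t\mathcal R_t,\qquad \mathcal A_t=\Pr\{t^*=t\},\qquad \mathcal R_t=\mathbb E\Big[\tfrac1{F_B^{(t)}}\ln(1+\mathrm{SINR}_t)\,\Big|\,t^*=t\Big].$$ Write $\mathrm{SNR}_q=P_q/\sigma_N^2$, $c_{t,q}=\frac{P_q}{P_t}\frac{B_q}{B_t}$, $\lambda_q'=\lambda_q/F_B^{(q)}$, $\mathcal M_{t,0}(s)=\mathbb E\{e^{-sg_{t,0}}\}$, $\mathcal M_{q,I}(s)=\mathbb E\{e^{-sg_{q,b}}\}$, $\mathcal M_{q,I}^{(k)}(s)=\mathbb E\{g_{q,b}^{k+1}e^{-sg_{q,b}}\}$, and $$\mathcal T_{q,I}(y)=\Gamma\!\left(1-\tfrac2\alpha\right)\sum_{k=0}^{\infty}\frac{y^{k+1}\mathcal M_{q,I}^{(k)}(y)}{\Gamma\left(2-\frac2\alpha+k\right)},$$ $$\tilde{\mathcal Z}_I^{(t,q)}(y)=c_{t,q}^{2/\alpha}\big(F_B^{(q)}-1\big)+c_{t,q}^{2/\alpha}\mathcal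 M_{q,I}\big(c_{t,q}^{-1}\mathrm{SNR}_q\,y\big)+c_{t,q}^{2/\alpha}\mathcal T_{q,I}\big(c_{t,q}^{-1}\mathrm{SNR}_q\,y\big),$$ $$\tilde{\mathcal Z}_I^{(t)}(y)=\sum_{q=1}^T\frac{\lambda_q'}{\lambda_t'}\tilde{\mathcal Z}_I^{(t,q)}(y),$$ $$\tilde{\mathcal G}_I^{(t)}(y)=\frac1{\tilde{\mathcal Z}_I^{(t)}(y)}-\frac\alpha2\,\frac{y}{\tilde{\mathcal Z}_I^{(t)}(y)}\int_0^\infty\xi^{\frac\alpha2-1}\exp\{-\pi\lambda_t'\tilde{\mathcal Z}_I^{(t)}(y)\,\xi\}\exp\{-y\,\xi^{\alpha/2}\}\,d\xi .$$ Then, for every tier $t$, $\mathcal A_t>0$, the series and the integrals converge, $\tilde{\mathcal Z}_I^{(t)}(y)>0$ for $y>0$, the conditional average rate is finite, and $$\tilde{\mathcal R}_t=\int_0^\infty\big[1-\mathcal M_{t,0}(\mathrm{SNR}_t\,y)\big]\frac{\tilde{\mathcal G}_I^{(t)}(y)}{y}\,dy .$$ -/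

import Mathlib

open MeasureTheory ProbabilityTheory Set
open scoped ENNReal

noncomputable section

/-! Poisson point processes -/

/-- Number of points of the (enumerated) random configuration `X 0, X 1, …` lying in `A`. -/
def pointCount {Ω E : Type*} (X : ℕ → Ω → E) (A : Set E) (ω : Ω) : ℝ≥0∞ :=
  ∑' b, A.indicator (fun _ => (1 : ℝ≥0∞)) (X b ω)

/-- `X` enumerates a Poisson point process with intensity measure `Λ`: the number of points in a
set of finite intensity is Poisson distributed, and the numbers of points in pairwise disjoint sets
are independent. -/
structure IsPoissonProcess {Ω E : Type*} [MeasurableSpace Ω] [MeasurableSpace E]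
    (X : ℕ → Ω → E) (Λ : Measure E) (μ : Measure Ω) : Prop where
  measurable : ∀ b, Measurable (X b)
  law : ∀ A : Set E, MeasurableSet A → Λ A ≠ ∞ →
    μ.map (pointCount X A) = (poissonMeasure (Λ A).toNNReal).map (fun n : ℕ => (n : ℝ≥0∞))
  indep : ∀ (n : ℕ) (A : Fin n → Set E), (∀ i, MeasurableSet (A i)) → (∀ i, Λ (A i) ≠ ∞) →
    Pairwise (fun i j => Disjoint (A i) (A j)) → iIndepFun (fun i => pointCount X (A i)) μ

/-! The parameters of a multi-tier cellular network with a common path-loss exponent -/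

/-- Parameters of a `T`-tier network. `servLaw q` is the law of the power gain of the serving link
when the serving base station is in tier `q`, `interfLaw q` the law of the power gain of an
interfering link of tier `q`, and `noise` is the noise power. -/
structure Network (T : ℕ) where
  density : Fin T → ℝ
  power : Fin T → ℝ
  bias : Fin T → ℝ
  bands : Fin T → ℕ
  alpha : ℝ
  noise : ℝ
  servLaw : Fin T → Measure ℝ
  interfLaw : Fin T → Measure ℝ

/-- The law of a power gain: a probability law on `[0, ∞)` with mean one. -/
structure IsFadingLaw (ν : Measure ℝ) : Prop where
  prob : IsProbabilityMeasure ν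
  nonneg : ∀ᵐ x ∂ν, 0 ≤ x
  mean_one : ∫ x, x ∂ν = 1

/-- The standing assumptions on the parameters. -/
structure Network.Admissible {T : ℕ} (N : Network T) : Prop where
  density_pos : ∀ q, 0 < N.density q
  power_pos : ∀ q, 0 < N.power q
  bias_pos : ∀ q, 0 < N.bias q
  one_le_bands : ∀ q, 1 ≤ N.bands q
  two_lt_alpha : 2 < N.alpha
  noise_pos : 0 < N.noise
  servLaw_fading : ∀ q, IsFadingLaw (N.servLaw q)
  interfLaw_fading : ∀ q, IsFadingLaw (N.interfLaw q)

/-! The random network seen from the origin -/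

/-- The random quantities: `pos q b` is the position of the `b`-th base station of tier `q`,
`gain q b` its power gain as an interferer, `band q b` the frequency band it picks, and `gain0 q`
is the power gain of the serving link when the terminal is served by tier `q`. -/
structure Deployment {T : ℕ} (N : Network T) (Ω : Type*) where
  pos : Fin T → ℕ → Ω → EuclideanSpace ℝ (Fin 2)
  gain : Fin T → ℕ → Ω → ℝ
  band : (q : Fin T) → ℕ → Ω → Fin (N.bands q)
  gain0 : Fin T → Ω → ℝ

/-- Labels of the sources of randomness of a deployment. -/
inductive Source (T : ℕ) where
  | pos (q : Fin T)
  | gain (q : Fin T) (b : ℕ)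
  | band (q : Fin T) (b : ℕ)
  | gain0 (q : Fin T)

namespace Deployment

variable {T : ℕ} {N : Network T} {Ω : Type*}

/-- The σ-algebra generated by one source of randomness. -/
@[reducible]
def sigma (D : Deployment N Ω) : Source T → MeasurableSpace Ω
  | Source.pos q => ⨆ b, MeasurableSpace.comap (D.pos q b) inferInstance
  | Source.gain q b => MeasurableSpace.comap (D.gain q b) inferInstance
  | Source.band q b => MeasurableSpace.comap (D.band q b) inferInstance
  | Source.gain0 q => MeasurableSpace.comap (D.gain0 q) inferInstance

/-- The probabilistic model: the tiers are homogeneous Poisson processes in the plane, gains have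
the prescribed laws, every base station picks its band uniformly at random among the bands of its
tier, and the point processes, the gains and the band choices are mutually independent. -/
structure IsModel [MeasurableSpace Ω] (D : Deployment N Ω) (μ : Measure Ω) : Prop where
  poisson : ∀ q, IsPoissonProcess (D.pos q) (ENNReal.ofReal (N.density q) • volume) μ
  measurable_gain : ∀ q b, Measurable (D.gain q b)
  measurable_band : ∀ q b, Measurable (D.band q b)
  measurable_gain0 : ∀ q, Measurable (D.gain0 q)
  law_gain : ∀ q b, μ.map (D.gain q b) = N.interfLaw q
  law_band : ∀ q b j, μ (D.band q b ⁻¹' {j}) = (N.bands q : ℝ≥0∞)⁻¹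
  law_gain0 : ∀ q, μ.map (D.gain0 q) = N.servLaw q
  indep : iIndep D.sigma μ

/-- Distance of the `b`-th base station of tier `q` from the terminal at the origin. -/
def dist (D : Deployment N Ω) (q : Fin T) (b : ℕ) (ω : Ω) : ℝ := ‖D.pos q b ω‖

/-- Distance of the nearest base station of tier `q`. -/
def nearest (D : Deployment N Ω) (q : Fin T) (ω : Ω) : ℝ := ⨅ b, D.dist q b ω

/-- The event that the terminal is associated with tier `t`: the nearest base station of tier `t`
has the largest biased average received power. (Ties have probability zero.) -/
def assoc (D : Deployment N Ω) (t : Fin T) : Set Ω :=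
  {ω | ∀ q, N.power q * D.nearest q ω ^ (-N.alpha) * N.bias q
    ≤ N.power t * D.nearest t ω ^ (-N.alpha) * N.bias t}

/-- The `b`-th base station of tier `q` interferes with a link served by the nearest base station
of tier `t`: it is not the serving base station, and it has picked the band `ch q`, which is the
band of its tier that the serving link occupies. -/
def Interferes (D : Deployment N Ω) (ch : (q : Fin T) → Fin (N.bands q)) (t q : Fin T) (b : ℕ)
    (ω : Ω) : Prop :=
  ¬ (q = t ∧ D.dist q b ω = D.nearest t ω) ∧ D.band q b ω = ch q

open Classical in
/-- Aggregate interference when the serving base station is the nearest one of tier `t`. -/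
def interference (D : Deployment N Ω) (ch : (q : Fin T) → Fin (N.bands q)) (t : Fin T)
    (ω : Ω) : ℝ≥0∞ :=
  ∑ q, ∑' b, if D.Interferes ch t q b ω then
    ENNReal.ofReal (N.power q * D.gain q b ω * D.dist q b ω ^ (-N.alpha)) else 0

/-- Signal-to-interference-plus-noise ratio of a link served by tier `t`. -/
def sinr (D : Deployment N Ω) (ch : (q : Fin T) → Fin (N.bands q)) (t : Fin T) (ω : Ω) : ℝ≥0∞ :=
  ENNReal.ofReal (N.power t * D.gain0 t ω * D.nearest t ω ^ (-N.alpha)) /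
    (ENNReal.ofReal N.noise + D.interference ch t ω)

/-- Instantaneous rate (in nats): one of the `bands t` bands is used at the Shannon rate. -/
def instRate (D : Deployment N Ω) (ch : (q : Fin T) → Fin (N.bands q)) (t : Fin T) (ω : Ω) : ℝ :=
  1 / (N.bands t : ℝ) * Real.log (1 + (D.sinr ch t ω).toReal)

/-- Probability of being associated with tier `t`. -/
def assocProb [MeasurableSpace Ω] (D : Deployment N Ω) (μ : Measure Ω) (t : Fin T) : ℝ :=
  μ.real (D.assoc t)

/-- Average rate conditioned on being associated with tier `t`. -/
def condRate [MeasurableSpace Ω] (D : Deployment N Ω) (μ : Measure Ω)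
    (ch : (q : Fin T) → Fin (N.bands q)) (t : Fin T) : ℝ :=
  ∫ ω, D.instRate ch t ω ∂(ProbabilityTheory.cond μ (D.assoc t))

/-- Contribution of tier `t` to the average rate: association probability times conditional
average rate. -/
def tierRate [MeasurableSpace Ω] (D : Deployment N Ω) (μ : Measure Ω)
    (ch : (q : Fin T) → Fin (N.bands q)) (t : Fin T) : ℝ :=
  D.assocProb μ t * D.condRate μ ch t

end Deployment

/-! The analytical expressions -/

/-- `E[exp (-s g)]` for a power gain `g` with law `ν`. -/
def fadingMGF (ν : Measure ℝ) (s : ℝ) : ℝ := ∫ x, Real.exp (-(s * x)) ∂ν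

/-- `E[g ^ (k + 1) exp (-s g)]` for a power gain `g` with law `ν`. -/
def fadingMoment (ν : Measure ℝ) (k : ℕ) (s : ℝ) : ℝ := ∫ x, x ^ (k + 1) * Real.exp (-(s * x)) ∂ν

/-- The `k`-th term of the series in `fadingT`. -/
def fadingTerm (ν : Measure ℝ) (α y : ℝ) (k : ℕ) : ℝ :=
  y ^ (k + 1) * fadingMoment ν k y * (Real.Gamma (2 - 2 / α + k))⁻¹

/-- The function `𝒯_I` attached to the fading law `ν` and the path-loss exponent `α`. -/
def fadingT (ν : Measure ℝ) (α y : ℝ) : ℝ := Real.Gamma (1 - 2 / α) * ∑' k, fadingTerm ν α y k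

namespace Network

variable {T : ℕ}

def snr (N : Network T) (q : Fin T) : ℝ := N.power q / N.noise

/-- `(P_q / P_t) (B_q / B_t)`. -/
def ratio (N : Network T) (t q : Fin T) : ℝ :=
  (N.power q / N.power t) * (N.bias q / N.bias t)

/-- The pairwise function `Z̃^{(t,q)}` with random frequency reuse. -/
def pairZ (N : Network T) (t q : Fin T) (y : ℝ) : ℝ :=
  N.ratio t q ^ (2 / N.alpha) * ((N.bands q : ℝ) - 1)
    + N.ratio t q ^ (2 / N.alpha) *
        fadingMGF (N.interfLaw q) ((N.ratio t q)⁻¹ * N.snr q * y)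
    + N.ratio t q ^ (2 / N.alpha) *
        fadingT (N.interfLaw q) N.alpha ((N.ratio t q)⁻¹ * N.snr q * y)

/-- The function `Z̃^{(t)}`, for the densities `lam`. -/
def tierZ (N : Network T) (lam : Fin T → ℝ) (t : Fin T) (y : ℝ) : ℝ :=
  ∑ q, lam q / lam t * N.pairZ t q y

/-- Integrand of the inner integral in `tierG`. -/
def innerIntegrand (N : Network T) (lam : Fin T → ℝ) (t : Fin T) (y ξ : ℝ) : ℝ :=
  ξ ^ (N.alpha / 2 - 1) * Real.exp (-(Real.pi * lam t * N.tierZ lam t y * ξ))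
    * Real.exp (-(y * ξ ^ (N.alpha / 2)))

/-- The function `G̃^{(t)}`, for the densities `lam`. -/
def tierG (N : Network T) (lam : Fin T → ℝ) (t : Fin T) (y : ℝ) : ℝ :=
  1 / N.tierZ lam t y
    - N.alpha / 2 * (y / N.tierZ lam t y) * ∫ ξ in Ioi (0 : ℝ), N.innerIntegrand lam t y ξ

/-- Integrand of the closed-form expression of the average rate, for the densities `lam`. -/
def outerIntegrand (N : Network T) (lam : Fin T → ℝ) (t : Fin T) (y : ℝ) : ℝ :=
  (1 - fadingMGF (N.servLaw t) (N.snr t * y)) * (N.tierG lam t y / y)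

/-- Densities `λ_q / F_q` of the base stations of the tiers that use a given band. -/
def reuseDensity (N : Network T) (q : Fin T) : ℝ := N.density q / N.bands q

end Network

end

open Filter Topology
open scoped NNReal

/-! The function `exp (-x)` on `[0, ∞]` -/

/-! The logarithm is linearised by a Frullani integral: `ln (1 + a/w)` is the integral over `y > 0`
of `(1 - e^{-ya}) e^{-yw} / y` (`lintegral_log_one_add_div`). Here `a = SNR_t g_{t,0}` and `w =
d_t^α (1 + I/σ²)`. Everything is nonnegative, so Tonelli applies, and the serving gain is
independent of the rest. The rate therefore reduces to the integral of `(1 - M_{t,0}(SNR_t y)) / y`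
times `E[1_{t* = t} exp(-y d_t^α (1 + I/σ²))]`. It remains to show that this expectation equals `F_t
G(y)`; the factor `F_t` cancels the `1/F_t` of the rate.

In terms of squared distances every tier is a Poisson process of constant rate `πλ_q` on the
half-line. If the serving station is at squared distance `r`, association with tier `t` says that
tier `q` has no point below `c_{t,q}^{2/α} r`. Giving such points an infinite exponent absorbs the
indicator into the exponential (`indicator_mul_expNeg`), which is why exponents live in `[0, ∞]`.
Gains and bands are averaged with the positions frozen: a station contributes the factor `1 - (1 -
M)/F`.

For tiers other than `t` the Laplace functional of a Poisson process (`IsPoissonProcess.laplace`)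
then gives `exp(-πλ'_q Z^{(t,q)} r)`. The series `T_I` enters through the integral over `u > 1` of
`1 - M(s u^{-α/2})`, which is `M(s) - 1 + T_I(s)` (`lintegral_Ioi_one_sub`). For tier `t` itself one
needs the joint law of the nearest point and the remaining ones (`lintegral_nearest`). It is
obtained without conditioning, by confining the minimum to a dyadic cell, taking a difference of two
Laplace functionals, and refining the cells.

Integrating over `r` gives `πλ_t` times the integral of `exp(-πλ'_t Z ξ - y ξ^{α/2})`, and one
integration by parts (`integral_exp_mul_exp_rpow`) turns this into `F_t G(y)`. Integrability of the
final integrand uses mean one near `y = 0` and `G(y) = O(y^{-2/α})` at infinity; it also gives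
finiteness of the conditional rate. -/

/-- `exp (-x)` for `x ∈ [0, ∞]`. -/
noncomputable def expNeg (x : ℝ≥0∞) : ℝ≥0∞ := EReal.exp (-(x : EReal))

@[simp]
lemma expNeg_zero : expNeg 0 = 1 := by simp [expNeg]

@[simp]
lemma expNeg_top : expNeg ∞ = 0 := by simp [expNeg]

lemma expNeg_ofReal {x : ℝ} (hx : 0 ≤ x) :
    expNeg (ENNReal.ofReal x) = ENNReal.ofReal (Real.exp (-x)) := by
  rw [expNeg, EReal.coe_ennreal_ofReal, max_eq_left hx, ← EReal.coe_neg, EReal.exp_coe]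

lemma expNeg_antitone : Antitone expNeg := fun x y h => by
  unfold expNeg
  apply EReal.exp_monotone
  simpa using h

lemma expNeg_le_one (x : ℝ≥0∞) : expNeg x ≤ 1 := by
  simpa using expNeg_antitone (zero_le (a := x))

lemma expNeg_ne_top (x : ℝ≥0∞) : expNeg x ≠ ∞ :=
  ne_top_of_le_ne_top ENNReal.one_ne_top (expNeg_le_one x)

lemma expNeg_add (x y : ℝ≥0∞) : expNeg (x + y) = expNeg x * expNeg y := by
  unfold expNeg
  rw [EReal.coe_ennreal_add, EReal.exp_neg, EReal.exp_neg, EReal.exp_neg, EReal.exp_add,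
    ENNReal.mul_inv (by left; simp) (by right; simp)]

lemma expNeg_sum {ι : Type*} (s : Finset ι) (f : ι → ℝ≥0∞) :
    expNeg (∑ i ∈ s, f i) = ∏ i ∈ s, expNeg (f i) := by
  classical
  induction s using Finset.induction_on with
  | empty => simp
  | insert a s ha ih => rw [Finset.sum_insert ha, Finset.prod_insert ha, expNeg_add, ih]

lemma continuous_expNeg : Continuous expNeg := by
  exact ENNReal.continuous_exp.comp (continuous_neg.comp continuous_coe_ennreal_ereal)

lemma measurable_expNeg : Measurable expNeg := continuous_expNeg.measurable

attribute [irreducible] expNeg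

lemma expNeg_nsmul (n : ℕ) (x : ℝ≥0∞) : expNeg (n * x) = expNeg x ^ n := by
  induction n with
  | zero => simp
  | succ n ih => rw [Nat.cast_succ, add_mul, one_mul, expNeg_add, ih, pow_succ]

/-- Laplace transform of the Poisson law. -/
lemma lintegral_expNeg_poissonMeasure (r : ℝ≥0) (c : ℝ≥0∞) :
    ∫⁻ n : ℕ, expNeg (n * c) ∂(poissonMeasure r) = expNeg (r * (1 - expNeg c)) := by
  have hc := expNeg_ne_top c
  obtain ⟨z, hz⟩ : ∃ z : ℝ≥0, (z : ℝ≥0∞) = expNeg c := WithTop.ne_top_iff_exists.1 hc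
  have hz1 : z ≤ 1 := by
    have := expNeg_le_one c
    rw [← hz] at this
    exact_mod_cast this
  simp_rw [expNeg_nsmul, ← hz]
  rw [lintegral_countable']
  simp_rw [poissonMeasure_singleton]
  have h1 : ∀ n : ℕ, (z : ℝ≥0∞) ^ n * ENNReal.ofReal (Real.exp (-r) * r ^ n / n.factorial)
      = ENNReal.ofReal (Real.exp (-r) * ((r * z : ℝ) ^ n / n.factorial)) := by
    intro n
    rw [← ENNReal.ofReal_coe_nnreal (p := z), ← ENNReal.ofReal_pow z.coe_nonneg,
      ← ENNReal.ofReal_mul (by positivity)]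
    congr 1
    rw [mul_pow]
    ring
  simp_rw [h1]
  rw [← ENNReal.ofReal_tsum_of_nonneg (fun n => by positivity)
    ((Real.summable_pow_div_factorial _).mul_left _), tsum_mul_left]
  have : ∑' n : ℕ, (r * z : ℝ) ^ n / n.factorial = Real.exp (r * z) := by
    rw [Real.exp_eq_exp_ℝ, NormedSpace.exp_eq_tsum_div]
  rw [this, ← Real.exp_add]
  have h2 : (r : ℝ≥0∞) * (1 - z) = ENNReal.ofReal (r * (1 - z)) := by
    rw [ENNReal.ofReal_mul r.coe_nonneg, ENNReal.ofReal_sub _ z.coe_nonneg]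
    simp
  rw [h2, expNeg_ofReal (mul_nonneg r.coe_nonneg (sub_nonneg.2 (by exact_mod_cast hz1)))]
  congr 2
  ring

/-! The Laplace functional of a Poisson process -/

section Poisson

variable {Ω E : Type*} [MeasurableSpace Ω] [MeasurableSpace E] {X : ℕ → Ω → E} {Λ : Measure E}
  {μ : Measure Ω}

lemma IsPoissonProcess.measurable_pointCount (hX : IsPoissonProcess X Λ μ) {A : Set E}
    (hA : MeasurableSet A) : Measurable (pointCount X A) := by
  unfold pointCount
  exact Measurable.tsum fun b =>
    (measurable_const.indicator hA).comp (hX.measurable b)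

/-- The value `c = ∞` is allowed and yields the void probability, because `expNeg (n * ∞)` is the
indicator of `n = 0`. -/
lemma IsPoissonProcess.lintegral_pointCount (hX : IsPoissonProcess X Λ μ) {A : Set E}
    (hA : MeasurableSet A) (hfin : Λ A ≠ ∞) (c : ℝ≥0∞) :
    ∫⁻ ω, expNeg (pointCount X A ω * c) ∂μ = expNeg (Λ A * (1 - expNeg c)) := by
  have hm : Measurable fun x : ℝ≥0∞ => expNeg (x * c) :=
    measurable_expNeg.comp (measurable_id.mul_const c)
  rw [← lintegral_map (f := fun x => expNeg (x * c)) hm (hX.measurable_pointCount hA),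
    hX.law A hA hfin, lintegral_map hm (measurable_of_countable _),
    lintegral_expNeg_poissonMeasure, ENNReal.coe_toNNReal hfin]

/-- The fibres over nonzero values are disjoint sets of finite intensity, so their counts are
independent Poisson variables and the expectation factorises. The fibre over `0` may have infinite
intensity, but contributes nothing to either side. -/
lemma IsPoissonProcess.lintegral_simpleFunc (hX : IsPoissonProcess X Λ μ)
    (f : SimpleFunc E ℝ≥0∞) (hf : ∀ c ≠ 0, Λ (f ⁻¹' {c}) ≠ ∞) :
    ∫⁻ ω, expNeg (∑' b, f (X b ω)) ∂μ = expNeg (∫⁻ x, (1 - expNeg (f x)) ∂Λ) := by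
  classical
  set s := f.range.filter (· ≠ 0)
  let e := s.equivFin
  let A : Fin s.card → Set E := fun i => f ⁻¹' {(e.symm i : ℝ≥0∞)}
  have hA : ∀ i, MeasurableSet (A i) := fun i => f.measurableSet_fiber _
  have hne : ∀ i, ((e.symm i : s) : ℝ≥0∞) ≠ 0 := fun i => (Finset.mem_filter.1 (e.symm i).2).2
  -- Needed for two functions vanishing at `0`: the identity, for the sum over points, and `1 -
  -- expNeg`, for the intensity integral.
  have hdecomp : ∀ (g : ℝ≥0∞ → ℝ≥0∞), g 0 = 0 → ∀ x,
      g (f x) = ∑ i, (A i).indicator (fun _ => (1 : ℝ≥0∞)) x * g (e.symm i) := by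
    intro g hg x
    rw [← e.sum_comp]
    simp only [A, Equiv.symm_apply_apply]
    rw [Finset.sum_coe_sort s (fun c => (f ⁻¹' {c}).indicator (fun _ => (1 : ℝ≥0∞)) x * g c)]
    by_cases h0 : f x = 0
    · rw [h0, hg, Finset.sum_eq_zero]
      intro c hc
      have : c ≠ 0 := (Finset.mem_filter.1 hc).2
      rw [indicator_of_notMem, zero_mul]
      simp [h0, this.symm]
    · rw [Finset.sum_eq_single (f x)]
      · simp
      · intro c _ hc
        rw [indicator_of_notMem, zero_mul]
        simpa using hc.symm
      · intro h
        exact absurd (Finset.mem_filter.2 ⟨f.mem_range_self x, h0⟩) h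
  have h1 : ∀ ω, ∑' b, f (X b ω) = ∑ i, pointCount X (A i) ω * (e.symm i : ℝ≥0∞) := by
    intro ω
    refine (tsum_congr fun b => hdecomp id rfl (X b ω)).trans ?_
    rw [Summable.tsum_finsetSum fun _ _ => ENNReal.summable]
    simp_rw [pointCount, ← ENNReal.tsum_mul_right]
    rfl
  have hind := hX.indep s.card A hA (fun i => hf _ (hne i)) (by
    intro i j hij
    refine Disjoint.preimage f (disjoint_singleton.2 fun h => hij ?_)
    exact e.symm.injective (Subtype.ext h))
  have hm : ∀ c, Measurable fun x : ℝ≥0∞ => expNeg (x * c) := fun c =>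
    measurable_expNeg.comp (measurable_id.mul_const c)
  simp_rw [h1, expNeg_sum]
  rw [lintegral_prod_eq_prod_lintegral_of_indepFun Finset.univ
    (fun i ω => expNeg (pointCount X (A i) ω * (e.symm i : ℝ≥0∞)))
    (hind.comp (fun i x => expNeg (x * (e.symm i : ℝ≥0∞))) fun i => hm _)
    (fun i => (hm _).comp (hX.measurable_pointCount (hA i)))]
  rw [Finset.prod_congr rfl fun i _ => hX.lintegral_pointCount (hA i) (hf _ (hne i)) _,
    ← expNeg_sum]
  congr 1
  rw [lintegral_congr (hdecomp (fun c => 1 - expNeg c) (by simp))]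
  rw [lintegral_finsetSum _ fun i _ => (measurable_const.indicator (hA i)).mul_const _]
  refine Finset.sum_congr rfl fun i _ => ?_
  rw [lintegral_mul_const _ (measurable_const.indicator (hA i)), lintegral_indicator (hA i)]
  simp

/-- Laplace functional of a Poisson process. -/
theorem IsPoissonProcess.laplace [SigmaFinite Λ] [IsFiniteMeasure μ] (hX : IsPoissonProcess X Λ μ)
    {a : E → ℝ≥0∞} (ha : Measurable a) :
    ∫⁻ ω, expNeg (∑' b, a (X b ω)) ∂μ = expNeg (∫⁻ x, (1 - expNeg (a x)) ∂Λ) := by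
  -- Restricting to the spanning sets makes every fibre over a nonzero value of finite intensity,
  -- while keeping the sequence increasing with limit `a`.
  let f : ℕ → SimpleFunc E ℝ≥0∞ := fun n =>
    (SimpleFunc.eapprox a n).restrict (spanningSets Λ n)
  have hfval : ∀ n x, f n x = (spanningSets Λ n).indicator (SimpleFunc.eapprox a n) x := by
    intro n x
    simp only [f]
    rw [SimpleFunc.restrict_apply _ (measurableSet_spanningSets Λ n)]
  have hmono : ∀ x, Monotone fun n => f n x := by
    intro x n m hnm
    simp only [hfval]
    refine (indicator_le_indicator_of_subset (monotone_spanningSets Λ hnm)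
      (fun _ => zero_le) x).trans ?_
    exact indicator_le_indicator (SimpleFunc.monotone_eapprox a hnm x)
  have hlim : ∀ x, Tendsto (fun n => f n x) atTop (𝓝 (a x)) := by
    intro x
    refine (SimpleFunc.tendsto_eapprox ha x).congr' ?_
    filter_upwards [eventually_ge_atTop (spanningSetsIndex Λ x)] with n hn
    rw [hfval, indicator_of_mem]
    exact mem_spanningSets_of_index_le Λ x hn
  have hfin : ∀ n, ∀ c ≠ 0, Λ (f n ⁻¹' {c}) ≠ ∞ := by
    intro n c hc
    refine ne_top_of_le_ne_top (measure_spanningSets_lt_top Λ n).ne (measure_mono ?_)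
    intro x hx
    by_contra h
    rw [mem_preimage, hfval, indicator_of_notMem h] at hx
    exact hc hx.symm
  have hA : Tendsto (fun n => ∫⁻ ω, expNeg (∑' b, f n (X b ω)) ∂μ) atTop
      (𝓝 (∫⁻ ω, expNeg (∑' b, a (X b ω)) ∂μ)) := by
    refine tendsto_lintegral_of_dominated_convergence (fun _ => 1) (fun n => ?_)
      (fun n => Eventually.of_forall fun ω => expNeg_le_one _) (by simp) ?_
    · exact measurable_expNeg.comp (Measurable.tsum fun b =>
        (f n).measurable.comp (hX.measurable b))
    · refine Eventually.of_forall fun ω => (continuous_expNeg.tendsto _).comp ?_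
      -- The sum over points is read as an integral against counting measure, so that monotone
      -- convergence applies to it.
      simp_rw [← lintegral_count' (measurable_of_countable _)]
      exact lintegral_tendsto_of_tendsto_of_monotone
        (fun n => (measurable_of_countable _).aemeasurable)
        (Eventually.of_forall fun b => hmono _) (Eventually.of_forall fun b => hlim _)
  have hB : Tendsto (fun n => expNeg (∫⁻ x, (1 - expNeg (f n x)) ∂Λ)) atTop
      (𝓝 (expNeg (∫⁻ x, (1 - expNeg (a x)) ∂Λ))) := by
    refine (continuous_expNeg.tendsto _).comp ?_
    refine lintegral_tendsto_of_tendsto_of_monotone (fun n => ?_) ?_ ?_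
    · exact (measurable_const.sub (measurable_expNeg.comp (f n).measurable)).aemeasurable
    · exact Eventually.of_forall fun x n m h => tsub_le_tsub_left (expNeg_antitone (hmono x h)) _
    · exact Eventually.of_forall fun x => ENNReal.Tendsto.sub tendsto_const_nhds
        ((continuous_expNeg.tendsto _).comp (hlim x)) (Or.inl ENNReal.one_ne_top)
  refine tendsto_nhds_unique hA (hB.congr fun n => ?_)
  exact (hX.lintegral_simpleFunc (f n) (hfin n)).symm

/-- The image of a Poisson process under a measurable map. -/
lemma IsPoissonProcess.map (hX : IsPoissonProcess X Λ μ) {F : Type*} [MeasurableSpace F]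
    {φ : E → F} (hφ : Measurable φ) : IsPoissonProcess (fun b ω => φ (X b ω)) (Λ.map φ) μ where
  measurable b := hφ.comp (hX.measurable b)
  law A hA hfin := by
    rw [Measure.map_apply hφ hA] at hfin ⊢
    exact hX.law _ (hφ hA) hfin
  indep n A hA hfin hdis := by
    refine hX.indep n (fun i => φ ⁻¹' A i) (fun i => hφ (hA i)) (fun i => ?_)
      (fun i j hij => (hdis hij).preimage φ)
    rw [← Measure.map_apply hφ (hA i)]
    exact hfin i

lemma IsPoissonProcess.ae_pointCount_ne_top (hX : IsPoissonProcess X Λ μ) {A : Set E}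
    (hA : MeasurableSet A) (hfin : Λ A ≠ ∞) : ∀ᵐ ω ∂μ, pointCount X A ω ≠ ∞ := by
  have h := hX.law A hA hfin
  have : μ.map (pointCount X A) {∞} = 0 := by
    rw [h, Measure.map_apply (measurable_of_countable _) (measurableSet_singleton _)]
    have : (fun n : ℕ => (n : ℝ≥0∞)) ⁻¹' {∞} = ∅ := by ext; simp
    rw [this, measure_empty]
  rw [Measure.map_apply (hX.measurable_pointCount hA) (measurableSet_singleton _)] at this
  exact measure_eq_zero_iff_ae_notMem.1 this

/-- With weight `c = ∞` the Laplace transform equals `1`, whereas its integrand is at most `1` and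
vanishes whenever some point lies in `A`. -/
lemma IsPoissonProcess.ae_notMem [IsProbabilityMeasure μ] (hX : IsPoissonProcess X Λ μ)
    {A : Set E} (hA : MeasurableSet A) (h0 : Λ A = 0) : ∀ᵐ ω ∂μ, ∀ b, X b ω ∉ A := by
  have h := hX.lintegral_pointCount hA (by simp [h0]) ∞
  rw [h0, zero_mul, expNeg_zero] at h
  have h1 : ∫⁻ ω, expNeg (pointCount X A ω * ∞) ∂μ = ∫⁻ ω, 1 ∂μ := by simp [h]
  have h2 := ae_eq_of_ae_le_of_lintegral_le
    (Eventually.of_forall fun ω => expNeg_le_one (pointCount X A ω * ∞)) (by simp [h])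
    aemeasurable_const h1.ge
  filter_upwards [h2] with ω hω b hb
  have hpos : pointCount X A ω ≠ 0 := by
    intro hz
    rw [pointCount, ENNReal.tsum_eq_zero] at hz
    simpa [hb] using hz b
  simp [ENNReal.mul_top hpos] at hω

end Poisson

/-! The squared distances of a planar process -/

lemma measurable_normSq_plane : Measurable fun x : EuclideanSpace ℝ (Fin 2) => ‖x‖ ^ 2 := by
  fun_prop

/-- A disc of squared radius `b` has area `πb`, linear in `b`. This is the reason for working with
squared distances: the image intensity is constant. -/
lemma map_normSq_volume :
    (volume : Measure (EuclideanSpace ℝ (Fin 2))).map (fun x => ‖x‖ ^ 2)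
      = ENNReal.ofReal Real.pi • volume.restrict (Ioi (0 : ℝ)) := by
  have hIic : ∀ b : ℝ, (volume : Measure (EuclideanSpace ℝ (Fin 2))).map (fun x => ‖x‖ ^ 2)
      (Iic b) = ENNReal.ofReal Real.pi * ENNReal.ofReal b := by
    intro b
    rw [Measure.map_apply measurable_normSq_plane measurableSet_Iic]
    rcases lt_or_ge b 0 with hb | hb
    · have : (fun x : EuclideanSpace ℝ (Fin 2) => ‖x‖ ^ 2) ⁻¹' Iic b = ∅ := by
        ext x
        simp only [mem_preimage, mem_Iic, mem_empty_iff_false, iff_false, not_le]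
        exact hb.trans_le (by positivity)
      rw [this, measure_empty, ENNReal.ofReal_of_nonpos hb.le, mul_zero]
    · have : (fun x : EuclideanSpace ℝ (Fin 2) => ‖x‖ ^ 2) ⁻¹' Iic b
          = Metric.closedBall 0 (Real.sqrt b) := by
        ext x
        simp only [mem_preimage, mem_Iic, mem_closedBall_zero_iff]
        rw [Real.le_sqrt (norm_nonneg _) hb]
      rw [this, EuclideanSpace.volume_closedBall_fin_two, ← ENNReal.ofReal_pow (Real.sqrt_nonneg _),
        Real.sq_sqrt hb, mul_comm]
  have hIoc : ∀ a b : ℝ, (volume : Measure (EuclideanSpace ℝ (Fin 2))).map (fun x => ‖x‖ ^ 2)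
      (Ioc a b) = ENNReal.ofReal Real.pi * (ENNReal.ofReal b - ENNReal.ofReal a) := by
    intro a b
    rw [show Ioc a b = Iic b \ Iic a by ext; simp [and_comm]]
    rcases le_total b a with h | h
    · rw [sdiff_eq_empty.2 (Iic_subset_Iic.2 h), measure_empty,
        tsub_eq_zero_of_le (ENNReal.ofReal_le_ofReal h), mul_zero]
    · rw [measure_sdiff (Iic_subset_Iic.2 h) measurableSet_Iic.nullMeasurableSet
        (by rw [hIic]; exact ENNReal.mul_ne_top ENNReal.ofReal_ne_top ENNReal.ofReal_ne_top),
        hIic, hIic, ENNReal.mul_sub fun _ _ => ENNReal.ofReal_ne_top]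
  have : IsLocallyFiniteMeasure
      ((volume : Measure (EuclideanSpace ℝ (Fin 2))).map (fun x => ‖x‖ ^ 2)) := by
    refine ⟨fun x => ⟨Iic (x + 1), Iic_mem_nhds (by linarith), ?_⟩⟩
    rw [hIic]
    exact ENNReal.mul_lt_top ENNReal.ofReal_lt_top ENNReal.ofReal_lt_top
  refine Measure.ext_of_Ioc _ _ fun a b hab => ?_
  rw [hIoc, Measure.smul_apply, Measure.restrict_apply measurableSet_Ioc, smul_eq_mul]
  congr 1
  have : Ioc a b ∩ Ioi 0 = Ioc (max a 0) b := by
    ext x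
    simp only [mem_inter_iff, mem_Ioc, mem_Ioi, max_lt_iff]
    tauto
  rw [this, Real.volume_Ioc]
  rcases le_total a 0 with ha | ha
  · rw [max_eq_right ha, ENNReal.ofReal_of_nonpos ha, tsub_zero, sub_zero]
  · rw [max_eq_left ha, ENNReal.ofReal_sub _ ha]

lemma IsPoissonProcess.normSq {Ω : Type*} [MeasurableSpace Ω] {μ : Measure Ω}
    {X : ℕ → Ω → EuclideanSpace ℝ (Fin 2)} {lam : ℝ} (hlam : 0 ≤ lam)
    (hX : IsPoissonProcess X (ENNReal.ofReal lam • volume) μ) :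
    IsPoissonProcess (fun b ω => ‖X b ω‖ ^ 2)
      (ENNReal.ofReal (Real.pi * lam) • volume.restrict (Ioi 0)) μ := by
  have h := hX.map measurable_normSq_plane
  rwa [Measure.map_smul, map_normSq_volume, smul_smul, ← ENNReal.ofReal_mul hlam,
    mul_comm lam] at h

/-- `ENNReal.ofReal r` unfolds to the coercion of `r.toNNReal`, for which σ-finiteness of the scaled
measure is known. -/
instance sigmaFinite_ofReal_smul_restrict (r : ℝ) (s : Set ℝ) :
    SigmaFinite (ENNReal.ofReal r • volume.restrict s) :=
  inferInstanceAs (SigmaFinite (r.toNNReal • volume.restrict s))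

/-! Dyadic approximation from below and above -/

/-- Ceilings rather than floors: the cells are then open on the left and closed on the right, so
they are differences of events `c < m`, and the lower endpoint lies strictly below `x`. -/
noncomputable def dyadicLo (n : ℕ) (x : ℝ) : ℝ := ((⌈2 ^ n * x⌉ : ℤ) - 1) / 2 ^ n
noncomputable def dyadicHi (n : ℕ) (x : ℝ) : ℝ := (⌈2 ^ n * x⌉ : ℤ) / 2 ^ n

lemma dyadicLo_lt (n : ℕ) (x : ℝ) : dyadicLo n x < x := by
  rw [dyadicLo, div_lt_iff₀ (by positivity), mul_comm x]
  linarith [Int.ceil_lt_add_one (2 ^ n * x)]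

lemma le_dyadicHi (n : ℕ) (x : ℝ) : x ≤ dyadicHi n x := by
  rw [dyadicHi, le_div_iff₀ (by positivity), mul_comm x]
  exact Int.le_ceil _

lemma dyadicHi_eq (n : ℕ) (x : ℝ) : dyadicHi n x = dyadicLo n x + (1 / 2) ^ n := by
  rw [dyadicHi, dyadicLo, one_div, inv_pow]
  field_simp
  ring

lemma dyadicLo_nonneg (n : ℕ) {x : ℝ} (hx : 0 < x) : 0 ≤ dyadicLo n x := by
  have : (1 : ℤ) ≤ ⌈2 ^ n * x⌉ := Int.one_le_ceil_iff.2 (by positivity)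
  have : (1 : ℝ) ≤ (⌈2 ^ n * x⌉ : ℤ) := by exact_mod_cast this
  unfold dyadicLo
  exact div_nonneg (by linarith) (by positivity)

lemma monotone_dyadicLo (x : ℝ) : Monotone fun n => dyadicLo n x := by
  refine monotone_nat_of_le_succ fun n => ?_
  have h : 2 * ⌈2 ^ n * x⌉ ≤ ⌈2 ^ (n + 1) * x⌉ + 1 := by
    have h1 : (2 ^ (n + 1) * x) ≤ ⌈2 ^ (n + 1) * x⌉ := Int.le_ceil _
    have h2 := Int.ceil_lt_add_one (2 ^ n * x)
    have : (2 * ⌈2 ^ n * x⌉ : ℝ) < ⌈2 ^ (n + 1) * x⌉ + 2 := by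
      rw [pow_succ] at h1 ⊢
      linarith
    have : 2 * ⌈2 ^ n * x⌉ < ⌈2 ^ (n + 1) * x⌉ + 2 := by exact_mod_cast this
    omega
  have h' : (2 * ⌈2 ^ n * x⌉ : ℝ) ≤ ⌈2 ^ (n + 1) * x⌉ + 1 := by exact_mod_cast h
  unfold dyadicLo
  rw [div_le_div_iff₀ (by positivity) (by positivity), pow_succ]
  rw [pow_succ] at h'
  have : (0 : ℝ) < 2 ^ n := by positivity
  nlinarith

lemma antitone_dyadicHi (x : ℝ) : Antitone fun n => dyadicHi n x := by
  refine antitone_nat_of_succ_le fun n => ?_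
  have h : ⌈2 ^ (n + 1) * x⌉ ≤ 2 * ⌈2 ^ n * x⌉ := by
    refine Int.ceil_le.2 ?_
    push_cast
    rw [pow_succ]
    linarith [Int.le_ceil (2 ^ n * x)]
  have h' : (⌈2 ^ (n + 1) * x⌉ : ℝ) ≤ 2 * ⌈2 ^ n * x⌉ := by exact_mod_cast h
  unfold dyadicHi
  rw [div_le_div_iff₀ (by positivity) (by positivity), pow_succ]
  rw [pow_succ] at h'
  have : (0 : ℝ) < 2 ^ n := by positivity
  nlinarith

lemma tendsto_dyadicLo (x : ℝ) : Tendsto (fun n => dyadicLo n x) atTop (𝓝 x) := by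
  have h : Tendsto (fun n : ℕ => x - (1 / 2 : ℝ) ^ n) atTop (𝓝 x) := by
    simpa using tendsto_const_nhds.sub
      (tendsto_pow_atTop_nhds_zero_of_lt_one (by norm_num : (0 : ℝ) ≤ 1 / 2) (by norm_num))
  refine tendsto_of_tendsto_of_tendsto_of_le_of_le h tendsto_const_nhds (fun n => ?_)
    fun n => (dyadicLo_lt n x).le
  have := le_dyadicHi n x
  rw [dyadicHi_eq] at this
  simp only
  linarith

lemma tendsto_dyadicHi (x : ℝ) : Tendsto (fun n => dyadicHi n x) atTop (𝓝 x) := by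
  simp_rw [dyadicHi_eq]
  simpa using (tendsto_dyadicLo x).add
      (tendsto_pow_atTop_nhds_zero_of_lt_one (by norm_num : (0 : ℝ) ≤ 1 / 2) (by norm_num))

lemma dyadic_of_mem_Ioc {n i : ℕ} {x : ℝ} (hx : x ∈ Ioc ((i : ℝ) / 2 ^ n) ((i + 1 : ℕ) / 2 ^ n)) :
    dyadicLo n x = i / 2 ^ n ∧ dyadicHi n x = (i + 1 : ℕ) / 2 ^ n := by
  have h : ⌈2 ^ n * x⌉ = (i : ℤ) + 1 := by
    rw [Int.ceil_eq_iff]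
    rw [mem_Ioc, div_lt_iff₀ (by positivity), le_div_iff₀ (by positivity)] at hx
    push_cast at hx ⊢
    constructor <;> linarith [hx.1, hx.2]
  rw [dyadicLo, dyadicHi, h]
  push_cast
  simp

lemma iUnion_dyadic_Ioc (n : ℕ) :
    ⋃ i : ℕ, Ioc ((i : ℝ) / 2 ^ n) ((i + 1 : ℕ) / 2 ^ n) = Ioi 0 := by
  ext x
  simp only [mem_iUnion, mem_Ioi]
  constructor
  · rintro ⟨i, hi⟩
    exact lt_of_le_of_lt (by positivity) hi.1
  · intro hx
    have : (1 : ℤ) ≤ ⌈2 ^ n * x⌉ := Int.one_le_ceil_iff.2 (by positivity)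
    obtain ⟨k, hk⟩ := Int.eq_ofNat_of_zero_le (sub_nonneg.2 this)
    refine ⟨k, ?_⟩
    have hk' : ⌈2 ^ n * x⌉ = (k : ℤ) + 1 := by omega
    rw [Int.ceil_eq_iff] at hk'
    rw [mem_Ioc, div_lt_iff₀ (by positivity), le_div_iff₀ (by positivity)]
    push_cast at hk' ⊢
    constructor <;> linarith [hk'.1, hk'.2]

lemma pairwise_disjoint_dyadic_Ioc (n : ℕ) :
    Pairwise (Function.onFun Disjoint
      fun i : ℕ => Ioc ((i : ℝ) / 2 ^ n) ((i + 1 : ℕ) / 2 ^ n)) := by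
  have hm : Monotone fun i : ℕ => (i : ℝ) / 2 ^ n := fun a b h => by
    have : (a : ℝ) ≤ b := by exact_mod_cast h
    exact div_le_div_of_nonneg_right this (by positivity)
  exact hm.pairwise_disjoint_on_Ioc_succ

lemma measurable_comp_ceil {β : Type*} [MeasurableSpace β] (n : ℕ) (g : ℤ → β) :
    Measurable fun x : ℝ => g ⌈2 ^ n * x⌉ :=
  (measurable_of_countable g).comp (Int.measurable_ceil.comp (measurable_const_mul _))

lemma measurable_dyadicLo (n : ℕ) : Measurable (dyadicLo n) :=
  measurable_comp_ceil n fun k => ((k : ℝ) - 1) / 2 ^ n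

lemma measurable_dyadicHi (n : ℕ) : Measurable (dyadicHi n) :=
  measurable_comp_ceil n fun k => (k : ℝ) / 2 ^ n

/-! The nearest point of a Poisson process on the half-line -/

/-- The mass that the exponential law gives to a cell, stated as a sum so as to avoid truncated
subtraction in `ℝ≥0∞`. -/
lemma lintegral_Ioc_expNeg {lam a b : ℝ} (hl : 0 < lam) (ha : 0 ≤ a) (hab : a ≤ b) :
    (∫⁻ x in Ioc a b, ENNReal.ofReal lam * expNeg (ENNReal.ofReal (lam * x)))
      + expNeg (ENNReal.ofReal (lam * b)) = expNeg (ENNReal.ofReal (lam * a)) := by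
  have h1 : ∫⁻ x in Ioc a b, ENNReal.ofReal lam * expNeg (ENNReal.ofReal (lam * x))
      = ∫⁻ x in Ioc a b, ENNReal.ofReal (lam * Real.exp (-(lam * x))) := by
    refine setLIntegral_congr_fun measurableSet_Ioc fun x hx => ?_
    rw [expNeg_ofReal (mul_nonneg hl.le (ha.trans hx.1.le)), ← ENNReal.ofReal_mul hl.le]
  have hcont : Continuous fun x : ℝ => lam * Real.exp (-(lam * x)) := by fun_prop
  have h2 : ∫ x in a..b, lam * Real.exp (-(lam * x))
      = Real.exp (-(lam * a)) - Real.exp (-(lam * b)) := by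
    have hd : ∀ x ∈ uIcc a b, HasDerivAt (fun x => - Real.exp (-(lam * x)))
        (lam * Real.exp (-(lam * x))) x := by
      intro x _
      exact (((hasDerivAt_id' x).const_mul lam).fun_neg.exp).fun_neg.congr_deriv (by ring)
    rw [intervalIntegral.integral_eq_sub_of_hasDerivAt hd (hcont.intervalIntegrable _ _)]
    ring
  rw [h1, ← ofReal_integral_eq_lintegral_ofReal (hcont.integrableOn_Ioc)
    (Eventually.of_forall fun x => by positivity), ← intervalIntegral.integral_of_le hab, h2,
    expNeg_ofReal (mul_nonneg hl.le (ha.trans hab)), expNeg_ofReal (mul_nonneg hl.le ha),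
    ← ENNReal.ofReal_add _ (by positivity)]
  · congr 1; ring
  · rw [sub_nonneg]
    gcongr

/-- Telescoping over unit cells. Only the upper bound is needed, to supply a finite dominating
integral. -/
lemma lintegral_Ioi_expNeg {lam : ℝ} (hl : 0 < lam) :
    ∫⁻ x in Ioi 0, ENNReal.ofReal lam * expNeg (ENNReal.ofReal (lam * x)) ≤ 1 := by
  rw [← iUnion_dyadic_Ioc 0]
  simp only [pow_zero, div_one]
  have hdis := pairwise_disjoint_dyadic_Ioc 0
  simp only [pow_zero, div_one] at hdis
  rw [lintegral_iUnion (fun i => measurableSet_Ioc) hdis]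
  refine ENNReal.tsum_le_of_sum_range_le fun n => ?_
  have : ∀ n : ℕ, ∑ i ∈ Finset.range n, (∫⁻ x in Ioc (i : ℝ) (i + 1 : ℕ),
      ENNReal.ofReal lam * expNeg (ENNReal.ofReal (lam * x)))
      + expNeg (ENNReal.ofReal (lam * n)) = 1 := by
    intro n
    induction n with
    | zero => simp
    | succ n ih =>
      rw [Finset.sum_range_succ, add_assoc, lintegral_Ioc_expNeg hl (by positivity)
        (by push_cast; linarith), ih]
  exact (le_add_of_nonneg_right zero_le).trans (this n).le

section Nearest

variable {Ω : Type*} [MeasurableSpace Ω] {μ : Measure Ω} [IsProbabilityMeasure μ]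
  {X : ℕ → Ω → ℝ} {lam : ℝ}

lemma IsPoissonProcess.ae_pos
    (hX : IsPoissonProcess X (ENNReal.ofReal lam • volume.restrict (Ioi 0)) μ) :
    ∀ᵐ ω ∂μ, ∀ b, 0 < X b ω := by
  have := hX.ae_notMem (A := Iic 0) measurableSet_Iic (by
    rw [Measure.smul_apply, Measure.restrict_apply measurableSet_Iic]
    have : Iic (0 : ℝ) ∩ Ioi 0 = ∅ := by ext; simp
    simp [this])
  filter_upwards [this] with ω h b
  simpa using h b

/-- Almost surely only finitely many points lie below any given integer, so the infimum is a minimum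
over a finite nonempty set. -/
lemma IsPoissonProcess.ae_exists_eq_iInf
    (hX : IsPoissonProcess X (ENNReal.ofReal lam • volume.restrict (Ioi 0)) μ) :
    ∀ᵐ ω ∂μ, ∃ b, X b ω = ⨅ b, X b ω := by
  have hfin : ∀ n : ℕ, ∀ᵐ ω ∂μ, pointCount X (Iic (n : ℝ)) ω ≠ ∞ := fun n =>
    hX.ae_pointCount_ne_top measurableSet_Iic (by
      rw [Measure.smul_apply, Measure.restrict_apply measurableSet_Iic, smul_eq_mul]
      refine ENNReal.mul_ne_top ENNReal.ofReal_ne_top ?_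
      rw [inter_comm, Ioi_inter_Iic, Real.volume_Ioc]
      exact ENNReal.ofReal_ne_top)
  filter_upwards [ae_all_iff.2 hfin, hX.ae_pos] with ω hω hpos
  obtain ⟨n, hn⟩ := exists_nat_ge (X 0 ω)
  have hS : {b | X b ω ≤ n}.Finite := by
    have h := ENNReal.finite_const_le_of_tsum_ne_top (hω n) one_ne_zero
    refine h.subset fun b hb => ?_
    have hb' : X b ω ∈ Iic (n : ℝ) := hb
    simp [indicator_of_mem hb']
  obtain ⟨b, hb, hmin⟩ := hS.exists_minimalFor (fun b => X b ω) _ ⟨0, hn⟩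
  have hle : ∀ c, X b ω ≤ X c ω := by
    intro c
    by_contra! h
    exact absurd (hmin (j := c) (h.le.trans hb) h.le) (not_le.2 h)
  exact ⟨b, le_antisymm (le_ciInf hle) (ciInf_le ⟨X b ω, forall_mem_range.2 hle⟩ b)⟩

/-- The law of the nearest point and of the other points of a homogeneous Poisson process on the
half-line: the nearest point is exponentially distributed, and given its position the other points
form a Poisson process beyond it. -/
theorem IsPoissonProcess.lintegral_nearest (hlam : 0 < lam)
    (hX : IsPoissonProcess X (ENNReal.ofReal lam • volume.restrict (Ioi 0)) μ)
    {K : ℝ → ℝ≥0∞} {H : ℝ → ℝ → ℝ≥0∞} (hK : Measurable K) (hH : Measurable (Function.uncurry H))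
    (hKcont : ContinuousOn K (Ici 0))
    (hHmono : ∀ x', 0 < x' → MonotoneOn (fun x => H x x') (Ici 0))
    (hHcont : ∀ x', 0 < x' → ContinuousOn (fun x => H x x') (Ici 0)) :
    ∫⁻ ω, expNeg (K (⨅ b, X b ω) + ∑' b, if (⨅ c, X c ω) < X b ω
        then H (⨅ c, X c ω) (X b ω) else 0) ∂μ
      = ∫⁻ x in Ioi 0, ENNReal.ofReal lam * expNeg (ENNReal.ofReal (lam * x)) *
        expNeg (K x + ENNReal.ofReal lam * ∫⁻ x' in Ioi 0,
          (1 - expNeg (if x < x' then H x x' else 0))) := by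
  set m : Ω → ℝ := fun ω => ⨅ b, X b ω with hm
  have hmm : Measurable m := Measurable.iInf hX.measurable
  -- The two endpoints of a cell replace the minimum: the upper one decides which points count as
  -- the others, the lower one is the first argument of `H`. As the cell shrinks, `a` increases to
  -- the true summand.
  set a : ℝ → ℝ → ℝ → ℝ≥0∞ := fun lo hi x' => if hi < x' then H lo x' else 0 with ha
  have ham : Measurable fun z : ℝ × ℝ × ℝ => a z.1 z.2.1 z.2.2 :=
    Measurable.ite (measurableSet_lt (by fun_prop) (by fun_prop))
      (hH.comp (measurable_fst.prodMk measurable_snd.snd)) measurable_const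
  have ham' : ∀ lo hi, Measurable (a lo hi) := fun lo hi =>
    ham.comp (measurable_const.prodMk (measurable_const.prodMk measurable_id))
  set B : ℝ → ℝ → ℝ≥0∞ := fun lo hi => expNeg (K lo + ENNReal.ofReal lam * ∫⁻ x' in Ioi 0,
          (1 - expNeg (a lo hi x'))) with hB
  have hpos := hX.ae_pos
  have hatt := hX.ae_exists_eq_iInf
  have hmpos : ∀ᵐ ω ∂μ, 0 < m ω := by
    filter_upwards [hpos, hatt] with ω h1 ⟨b, hb⟩
    simp only [hm]
    rw [← hb]
    exact h1 b
  have hgt : ∀ᵐ ω ∂μ, ∀ c, c < m ω ↔ ∀ b, c < X b ω := by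
    filter_upwards [hpos, hatt] with ω h1 ⟨b, hb⟩ c
    constructor
    · intro h b'
      exact h.trans_le (ciInf_le ⟨0, forall_mem_range.2 fun b => (h1 b).le⟩ b')
    · intro h
      simp only [hm]
      rw [← hb]
      exact h b
  -- the avoidance probabilities
  have key : ∀ lo hi c, 0 ≤ c → c ≤ hi →
      ∫⁻ ω in {ω | c < m ω}, expNeg (K lo + ∑' b, a lo hi (X b ω)) ∂μ
        = expNeg (ENNReal.ofReal (lam * c)) * B lo hi := by
    intro lo hi c hc0 hc
    have hset : MeasurableSet {ω | c < m ω} := measurableSet_lt measurable_const hmm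
    -- An infinite weight on `(-∞, c]` makes the exponential vanish unless all points exceed `c`, so
    -- the restriction to `c < m` becomes part of a Laplace functional.
    set a' : ℝ → ℝ≥0∞ := fun x' => if x' ≤ c then ∞ else a lo hi x' with ha'
    have ha'm : Measurable a' := Measurable.ite measurableSet_Iic measurable_const (ham' _ _)
    rw [← lintegral_indicator hset]
    have h1 : ∫⁻ ω, {ω | c < m ω}.indicator (fun ω => expNeg (K lo + ∑' b, a lo hi (X b ω))) ω ∂μ
        = ∫⁻ ω, expNeg (K lo) * expNeg (∑' b, a' (X b ω)) ∂μ := by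
      refine lintegral_congr_ae ?_
      filter_upwards [hgt] with ω hω
      by_cases h : c < m ω
      · rw [indicator_of_mem (show ω ∈ {ω | c < m ω} from h), expNeg_add]
        congr 3
        funext b
        simp only [ha', if_neg (not_le.2 ((hω c).1 h b))]
      · rw [indicator_of_notMem (show ω ∉ {ω | c < m ω} from h)]
        rw [hω] at h
        push Not at h
        obtain ⟨b, hb⟩ := h
        have : ∑' b, a' (X b ω) = ∞ := by
          refine ENNReal.tsum_eq_top_of_eq_top ⟨b, ?_⟩
          simp [ha', hb]
        rw [this, expNeg_top, mul_zero]
    rw [h1, lintegral_const_mul _ (show Measurable fun ω => expNeg (∑' b, a' (X b ω)) from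
      measurable_expNeg.comp (Measurable.tsum fun b => ha'm.comp (hX.measurable b))), hX.laplace ha'm,
      lintegral_smul_measure]
    -- Since `c ≤ hi`, the weight `a lo hi` vanishes below `c`, so the two contributions have
    -- disjoint supports.
    have h2 : ∫⁻ x' in Ioi 0, (1 - expNeg (a' x'))
        = ENNReal.ofReal c + ∫⁻ x' in Ioi 0, (1 - expNeg (a lo hi x')) := by
      have : ∀ x', 1 - expNeg (a' x')
          = (Iic c).indicator (fun _ => 1) x' + (1 - expNeg (a lo hi x')) := by
        intro x'
        by_cases h : x' ≤ c
        · have h3 : a lo hi x' = 0 := by simp [ha, (h.trans hc)]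
          simp [ha', h, h3]
        · simp [ha', h]
      simp_rw [this]
      rw [lintegral_add_left (measurable_const.indicator measurableSet_Iic),
        lintegral_indicator measurableSet_Iic, lintegral_const, one_mul,
        Measure.restrict_restrict measurableSet_Iic, Measure.restrict_apply_univ, inter_comm,
        Ioi_inter_Iic, Real.volume_Ioc, sub_zero]
    rw [h2, smul_eq_mul, mul_add, expNeg_add, hB]
    simp only
    rw [expNeg_add, ENNReal.ofReal_mul hlam.le]
    ring
  -- one dyadic interval
  have piece : ∀ lo hi, 0 ≤ lo → lo ≤ hi →
      ∫⁻ ω in m ⁻¹' Ioc lo hi, expNeg (K lo + ∑' b, a lo hi (X b ω)) ∂μ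
        = ∫⁻ x in Ioc lo hi, ENNReal.ofReal lam * expNeg (ENNReal.ofReal (lam * x)) * B lo hi := by
    intro lo hi h0 h
    have hset : MeasurableSet {ω | hi < m ω} := measurableSet_lt measurable_const hmm
    -- The cell is the difference of the events `lo < m` and `hi < m`, with the same integrand on
    -- both. The factor `B lo hi` is common, and what is left is the exponential mass of the cell.
    have e1 := key lo hi lo h0 h
    have e2 := key lo hi hi (h0.trans h) le_rfl
    have hsplit : {ω | lo < m ω} = m ⁻¹' Ioc lo hi ∪ {ω | hi < m ω} := by
      ext ω
      simp only [mem_ofPred_eq, mem_union, mem_preimage, mem_Ioc]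
      constructor
      · intro h'
        rcases le_or_gt (m ω) hi with h'' | h''
        · exact Or.inl ⟨h', h''⟩
        · exact Or.inr h''
      · rintro (h' | h')
        · exact h'.1
        · exact h.trans_lt h'
    rw [hsplit, lintegral_union hset (by
      rw [Set.disjoint_left]
      rintro ω ⟨_, h1⟩ h2
      exact absurd h2 (not_lt.2 h1)), e2, ← lintegral_Ioc_expNeg hlam h0 h, add_mul] at e1
    rw [lintegral_mul_const _ (by
      exact (measurable_expNeg.comp (by fun_prop)).const_mul _)]
    exact (ENNReal.add_left_inj
      (ENNReal.mul_ne_top (expNeg_ne_top _) (expNeg_ne_top _))).1 e1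
  -- the identity for the approximations
  have approx : ∀ n : ℕ,
      ∫⁻ ω, expNeg (K (dyadicLo n (m ω)) +
          ∑' b, a (dyadicLo n (m ω)) (dyadicHi n (m ω)) (X b ω)) ∂μ
        = ∫⁻ x in Ioi 0, ENNReal.ofReal lam * expNeg (ENNReal.ofReal (lam * x)) *
          B (dyadicLo n x) (dyadicHi n x) := by
    intro n
    have hr : μ.restrict (m ⁻¹' Ioi 0) = μ :=
      Measure.restrict_eq_self_of_ae_mem (by filter_upwards [hmpos] with ω h; exact h)
    conv_lhs => rw [← hr]
    rw [← iUnion_dyadic_Ioc n, preimage_iUnion,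
      lintegral_iUnion (fun i => hmm measurableSet_Ioc)
        (fun i j hij => (pairwise_disjoint_dyadic_Ioc n hij).preimage m),
      lintegral_iUnion (fun i => measurableSet_Ioc) (pairwise_disjoint_dyadic_Ioc n)]
    congr 1
    funext i
    have hle : (i : ℝ) / 2 ^ n ≤ (i + 1 : ℕ) / 2 ^ n := by
      push_cast
      gcongr
      linarith
    refine Eq.trans ?_ ((piece _ _ (by positivity) hle).trans ?_)
    · refine setLIntegral_congr_fun (hmm measurableSet_Ioc) fun ω hω => ?_
      obtain ⟨h1, h2⟩ := dyadic_of_mem_Ioc hω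
      simp only [h1, h2]
    · refine setLIntegral_congr_fun measurableSet_Ioc fun x hx => ?_
      obtain ⟨h1, h2⟩ := dyadic_of_mem_Ioc hx
      simp only [h1, h2]
  -- monotone convergence of the exponents
  have a_mono : ∀ x x', 0 < x → 0 < x' →
      Monotone fun n => a (dyadicLo n x) (dyadicHi n x) x' := by
    intro x x' hx hx' n k hnk
    simp only [ha]
    have h1 := antitone_dyadicHi x hnk
    have h2 := monotone_dyadicLo x hnk
    simp only at h1 h2
    split_ifs with h3 h4
    · exact hHmono x' hx' (dyadicLo_nonneg n hx) (dyadicLo_nonneg k hx) h2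
    · exact absurd (h1.trans_lt h3) h4
    · exact zero_le
    · exact le_rfl
  have a_lim : ∀ x x', 0 < x → 0 < x' →
      Tendsto (fun n => a (dyadicLo n x) (dyadicHi n x) x') atTop (𝓝 (a x x x')) := by
    intro x x' hx hx'
    simp only [ha]
    by_cases h : x < x'
    · have hc : Tendsto (fun n => H (dyadicLo n x) x') atTop (𝓝 (H x x')) :=
        (hHcont x' hx' x hx.le).tendsto.comp
          (tendsto_nhdsWithin_iff.2 ⟨tendsto_dyadicLo x,
            Eventually.of_forall fun n => dyadicLo_nonneg n hx⟩)
      rw [if_pos h]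
      refine hc.congr' ?_
      filter_upwards [(tendsto_dyadicHi x).eventually (gt_mem_nhds h)] with n hn
      rw [if_pos hn]
    · rw [if_neg h]
      refine tendsto_const_nhds.congr fun n => ?_
      rw [if_neg]
      exact fun h' => h ((le_dyadicHi n x).trans_lt h')
  have K_lim : ∀ x, 0 < x → Tendsto (fun n => K (dyadicLo n x)) atTop (𝓝 (K x)) := fun x hx =>
    (hKcont x hx.le).tendsto.comp
      (tendsto_nhdsWithin_iff.2 ⟨tendsto_dyadicLo x,
        Eventually.of_forall fun n => dyadicLo_nonneg n hx⟩)
  have lim1 : Tendsto (fun n => ∫⁻ ω, expNeg (K (dyadicLo n (m ω)) +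
          ∑' b, a (dyadicLo n (m ω)) (dyadicHi n (m ω)) (X b ω)) ∂μ) atTop
      (𝓝 (∫⁻ ω, expNeg (K (m ω) + ∑' b, a (m ω) (m ω) (X b ω)) ∂μ)) := by
    refine tendsto_lintegral_of_dominated_convergence (fun _ => 1) (fun n => ?_)
      (fun n => Eventually.of_forall fun ω => expNeg_le_one _) (by simp) ?_
    · refine measurable_expNeg.comp (Measurable.add
        (hK.comp ((measurable_dyadicLo n).comp hmm)) (Measurable.tsum fun b => ?_))
      exact ham.comp (((measurable_dyadicLo n).comp hmm).prodMk
        (((measurable_dyadicHi n).comp hmm).prodMk (hX.measurable b)))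
    · filter_upwards [hpos, hmpos] with ω h1 h2
      refine (continuous_expNeg.tendsto _).comp ((K_lim _ h2).add ?_)
      simp_rw [← lintegral_count' (measurable_of_countable _)]
      exact lintegral_tendsto_of_tendsto_of_monotone
        (fun n => (measurable_of_countable _).aemeasurable)
        (Eventually.of_forall fun b => a_mono _ _ h2 (h1 b))
        (Eventually.of_forall fun b => a_lim _ _ h2 (h1 b))
  have lim2 : Tendsto (fun n => ∫⁻ x in Ioi 0, ENNReal.ofReal lam *
      expNeg (ENNReal.ofReal (lam * x)) * B (dyadicLo n x) (dyadicHi n x)) atTop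
      (𝓝 (∫⁻ x in Ioi 0, ENNReal.ofReal lam * expNeg (ENNReal.ofReal (lam * x)) * B x x)) := by
    refine tendsto_lintegral_of_dominated_convergence
      (fun x => ENNReal.ofReal lam * expNeg (ENNReal.ofReal (lam * x))) (fun n => ?_)
      (fun n => Eventually.of_forall fun ω => mul_le_of_le_one_right zero_le (expNeg_le_one _))
      (ne_top_of_le_ne_top ENNReal.one_ne_top (lintegral_Ioi_expNeg hlam)) ?_
    · refine Measurable.mul ((measurable_expNeg.comp (by fun_prop)).const_mul _) ?_
      -- The approximated integrand factors through an integer, so no measurability of `B` has to be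
      -- established.
      exact measurable_comp_ceil n fun k => B (((k : ℝ) - 1) / 2 ^ n) ((k : ℝ) / 2 ^ n)
    · filter_upwards [ae_restrict_mem measurableSet_Ioi] with x hx
      refine ENNReal.Tendsto.const_mul ?_
        (Or.inr (ENNReal.mul_ne_top ENNReal.ofReal_ne_top (expNeg_ne_top _)))
      refine (continuous_expNeg.tendsto _).comp ((K_lim _ hx).add ?_)
      refine ENNReal.Tendsto.const_mul ?_ (Or.inr ENNReal.ofReal_ne_top)
      refine lintegral_tendsto_of_tendsto_of_monotone (fun n => ?_) ?_ ?_
      · exact (measurable_const.sub (measurable_expNeg.comp (ham' _ _))).aemeasurable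
      · filter_upwards [ae_restrict_mem measurableSet_Ioi] with x' hx' n k h
        exact tsub_le_tsub_left (expNeg_antitone (a_mono x x' hx hx' h)) _
      · filter_upwards [ae_restrict_mem measurableSet_Ioi] with x' hx'
        exact ENNReal.Tendsto.sub tendsto_const_nhds
          ((continuous_expNeg.tendsto _).comp (a_lim x x' hx hx')) (Or.inl ENNReal.one_ne_top)
  exact tendsto_nhds_unique lim1 (lim2.congr fun n => (approx n).symm)

end Nearest

/-! Elementary integrals -/

lemma lintegral_Ioo_mul_exp_neg {x c : ℝ} (hx : 0 ≤ x) (hc : 0 ≤ c) :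
    ∫⁻ v in Ioo 0 c, ENNReal.ofReal (x * Real.exp (-(x * v)))
      = ENNReal.ofReal (1 - Real.exp (-(x * c))) := by
  have hcont : Continuous fun v : ℝ => x * Real.exp (-(x * v)) := by fun_prop
  rw [setLIntegral_congr Ioo_ae_eq_Ioc,
    ← ofReal_integral_eq_lintegral_ofReal (hcont.integrableOn_Ioc)
      (Eventually.of_forall fun x => by positivity), ← intervalIntegral.integral_of_le hc]
  have hd : ∀ v ∈ uIcc 0 c, HasDerivAt (fun v => - Real.exp (-(x * v)))
      (x * Real.exp (-(x * v))) v := fun v _ =>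
    (((hasDerivAt_id' v).const_mul x).fun_neg.exp).fun_neg.congr_deriv (by ring)
  rw [intervalIntegral.integral_eq_sub_of_hasDerivAt hd (hcont.intervalIntegrable _ _)]
  congr 1
  simp
  ring

lemma lintegral_Ioi_exp_neg_mul {w : ℝ} (hw : 0 < w) :
    ∫⁻ y in Ioi 0, ENNReal.ofReal (Real.exp (-(y * w))) = ENNReal.ofReal (1 / w) := by
  have h : ∀ y : ℝ, -(y * w) = -w * y := fun y => by ring
  simp_rw [h]
  rw [← ofReal_integral_eq_lintegral_ofReal
    (integrableOn_exp_mul_Ioi (by linarith) 0) (Eventually.of_forall fun x => by positivity),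
    integral_exp_mul_Ioi (by linarith)]
  congr 1
  simp

/-- The Frullani type representation of the logarithm. -/
lemma lintegral_log_one_add_div {a w : ℝ} (ha : 0 ≤ a) (hw : 0 < w) :
    ∫⁻ y in Ioi 0, ENNReal.ofReal ((1 - Real.exp (-(y * a))) * Real.exp (-(y * w)) / y)
      = ENNReal.ofReal (Real.log (1 + a / w)) := by
  have h1 : ∀ y ∈ Ioi (0 : ℝ),
      ENNReal.ofReal ((1 - Real.exp (-(y * a))) * Real.exp (-(y * w)) / y)
        = ∫⁻ u in Ioo 0 a, ENNReal.ofReal (Real.exp (-(y * (u + w)))) := by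
    intro y hy
    have hy' : (0 : ℝ) < y := hy
    have e : (1 - Real.exp (-(y * a))) * Real.exp (-(y * w)) / y
        = (Real.exp (-(y * w)) / y) * (1 - Real.exp (-(y * a))) := by ring
    rw [e, ENNReal.ofReal_mul (by positivity), ← lintegral_Ioo_mul_exp_neg hy'.le ha,
      ← lintegral_const_mul _ (by fun_prop)]
    refine lintegral_congr fun u => ?_
    rw [← ENNReal.ofReal_mul (by positivity)]
    congr 1
    rw [mul_add, neg_add, Real.exp_add]
    field_simp
  rw [setLIntegral_congr_fun measurableSet_Ioi h1, lintegral_lintegral_swap (by fun_prop)]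
  have h2 : ∀ u ∈ Ioo 0 a, ∫⁻ y in Ioi 0, ENNReal.ofReal (Real.exp (-(y * (u + w))))
      = ENNReal.ofReal (1 / (u + w)) := fun u hu =>
    lintegral_Ioi_exp_neg_mul (add_pos hu.1 hw)
  rw [setLIntegral_congr_fun measurableSet_Ioo h2, setLIntegral_congr Ioo_ae_eq_Ioc]
  have hc : ContinuousOn (fun u : ℝ => 1 / (u + w)) (Icc 0 a) := by
    refine continuousOn_const.div (by fun_prop) fun u hu => ?_
    linarith [hu.1]
  rw [← ofReal_integral_eq_lintegral_ofReal (hc.integrableOn_Icc.mono_set Ioc_subset_Icc_self)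
    (by
      filter_upwards [ae_restrict_mem measurableSet_Ioc] with u hu
      have := hu.1
      simp only [Pi.zero_apply]
      positivity), ← intervalIntegral.integral_of_le ha,
    intervalIntegral.integral_comp_add_right (fun u => 1 / u), integral_one_div_of_pos (by linarith)
      (by linarith)]
  congr 2
  field_simp
  ring

/-! The transform of a fading law -/

section Fading

/-- Write `1 - exp(-x u^{-α/2})` as the integral of `x e^{-xv}` over `0 < v < u^{-α/2}` and exchange
the order. For fixed `v < 1` the variable `u` runs over `(1, v^{-2/α})`, of length `v^{-2/α} - 1`;
the second summand on the left restores the missing `1`. -/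
lemma lintegral_one_sub_exp_rpow {α x : ℝ} (hα : 2 < α) (hx : 0 ≤ x) :
    (∫⁻ u in Ioi 1, ENNReal.ofReal (1 - Real.exp (-(x * u ^ (-(α / 2))))))
      + ENNReal.ofReal (1 - Real.exp (-x))
      = ∫⁻ v in Ioo 0 1, ENNReal.ofReal (x * Real.exp (-(x * v)) * v ^ (-(2 / α))) := by
  have hα0 : 0 < α := by linarith
  set f : ℝ → ℝ≥0∞ := fun v => ENNReal.ofReal (x * Real.exp (-(x * v))) with hf
  have hfm : Measurable f := by fun_prop
  have key : ∀ u v : ℝ, 1 < u → 0 < v → (v < u ^ (-(α / 2)) ↔ u < v ^ (-(2 / α))) := by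
    intro u v hu hv
    have hu0 : 0 < u := by linarith
    have h := Real.lt_rpow_inv_iff_of_neg hu0 hv (z := -(α / 2)) (by linarith)
    have e : (-(α / 2))⁻¹ = -(2 / α) := by rw [inv_neg, inv_div]
    rw [e] at h
    exact h.symm
  have h1 : ∀ u ∈ Ioi (1 : ℝ), ENNReal.ofReal (1 - Real.exp (-(x * u ^ (-(α / 2)))))
      = ∫⁻ v in Ioo 0 1, (Ioo (1 : ℝ) (v ^ (-(2 / α)))).indicator (fun _ => f v) u := by
    intro u hu
    have hu' : (1 : ℝ) < u := hu
    have hu1 : u ^ (-(α / 2)) ≤ 1 :=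
      Real.rpow_le_one_of_one_le_of_nonpos hu'.le (by linarith)
    rw [← lintegral_Ioo_mul_exp_neg hx (by positivity),
      show Ioo 0 (u ^ (-(α / 2))) = Ioo 0 (u ^ (-(α / 2))) ∩ Ioo 0 1 from
        (inter_eq_self_of_subset_left (s := Ioo 0 (u ^ (-(α / 2)))) (t := Ioo 0 1)
          fun v hv => ⟨hv.1, hv.2.trans_le hu1⟩).symm,
      ← setLIntegral_indicator measurableSet_Ioo]
    refine setLIntegral_congr_fun measurableSet_Ioo fun v hv => ?_
    simp only [indicator, mem_Ioo, hv.1, hu', true_and, key u v hu' hv.1]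
    rfl
  have hm : Measurable fun z : ℝ × ℝ =>
      (Ioo (1 : ℝ) (z.2 ^ (-(2 / α)))).indicator (fun _ => f z.2) z.1 := by
    have : (fun z : ℝ × ℝ => (Ioo (1 : ℝ) (z.2 ^ (-(2 / α)))).indicator (fun _ => f z.2) z.1)
        = {z : ℝ × ℝ | 1 < z.1 ∧ z.1 < z.2 ^ (-(2 / α))}.indicator (fun z => f z.2) := by
      ext z
      simp only [indicator, mem_Ioo, mem_ofPred_eq]
    rw [this]
    refine (hfm.comp measurable_snd).indicator ?_
    exact (measurableSet_lt measurable_const measurable_fst).inter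
      (measurableSet_lt measurable_fst (measurable_snd.pow_const _))
  rw [setLIntegral_congr_fun measurableSet_Ioi h1, lintegral_lintegral_swap hm.aemeasurable,
    ← (by simpa using lintegral_Ioo_mul_exp_neg hx zero_le_one :
      ∫⁻ v in Ioo 0 1, f v = ENNReal.ofReal (1 - Real.exp (-x))), ← lintegral_add_right _ hfm]
  refine setLIntegral_congr_fun measurableSet_Ioo fun v hv => ?_
  have hv1 : 1 ≤ v ^ (-(2 / α)) :=
    Real.one_le_rpow_of_pos_of_le_one_of_nonpos hv.1 hv.2.le (by
      rw [neg_nonpos]; positivity)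
  rw [lintegral_indicator measurableSet_Ioo, lintegral_const,
    Measure.restrict_restrict measurableSet_Ioo, Measure.restrict_apply_univ,
    inter_eq_self_of_subset_left (Ioo_subset_Ioi_self), Real.volume_Ioo]
  have hv0 : 0 ≤ v ^ (-(2 / α)) := by linarith
  nth_rewrite 2 [← mul_one (f v)]
  rw [← mul_add, ← ENNReal.ofReal_one, ← ENNReal.ofReal_add (by linarith) zero_le_one, hf]
  simp only
  rw [← ENNReal.ofReal_mul (by positivity)]
  congr 1
  ring

/-- The Beta integral `B(1 - δ, k + 1)`, read off from the normalisation of the Beta density. -/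
lemma lintegral_Ioo_beta {δ : ℝ} (hδ : δ < 1) (k : ℕ) :
    ∫⁻ v in Ioo 0 1, ENNReal.ofReal (v ^ (-δ) * (1 - v) ^ k)
      = ENNReal.ofReal (Real.Gamma (1 - δ) * k.factorial / Real.Gamma (2 - δ + k)) := by
  have hb : 0 < beta (1 - δ) (k + 1) := beta_pos (by linarith) (by positivity)
  have h := lintegral_betaPDF_eq_one (α := 1 - δ) (β := k + 1) (by linarith) (by positivity)
  rw [lintegral_betaPDF] at h
  have e : ∀ v ∈ Ioo (0 : ℝ) 1, ENNReal.ofReal (v ^ (-δ) * (1 - v) ^ k)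
      = ENNReal.ofReal (beta (1 - δ) (k + 1)) * ENNReal.ofReal
        (1 / beta (1 - δ) (k + 1) * v ^ (1 - δ - 1) * (1 - v) ^ ((k + 1 : ℝ) - 1)) := by
    intro v hv
    rw [← ENNReal.ofReal_mul hb.le]
    congr 1
    rw [add_sub_cancel_right, Real.rpow_natCast, show 1 - δ - 1 = -δ by ring]
    field_simp
  rw [setLIntegral_congr_fun measurableSet_Ioo e, lintegral_const_mul _ (by fun_prop), h, mul_one,
    beta, Real.Gamma_nat_eq_factorial]
  congr 3
  ring

/-- Factor `e^{-xv} = e^{-x} e^{x(1-v)}` and expand the second exponential: all terms are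
nonnegative and each is a Beta integral. This is the origin of the series `T_I`. -/
lemma lintegral_Ioo_exp_rpow_eq_tsum {α x : ℝ} (hα : 2 < α) (hx : 0 ≤ x) :
    ∫⁻ v in Ioo 0 1, ENNReal.ofReal (x * Real.exp (-(x * v)) * v ^ (-(2 / α)))
      = ∑' k : ℕ, ENNReal.ofReal (Real.Gamma (1 - 2 / α) *
          (x ^ (k + 1) * Real.exp (-x) * (Real.Gamma (2 - 2 / α + k))⁻¹)) := by
  have hδ : 2 / α < 1 := by rw [div_lt_one (by linarith)]; exact hα
  have h1 : ∀ v ∈ Ioo (0 : ℝ) 1,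
      ENNReal.ofReal (x * Real.exp (-(x * v)) * v ^ (-(2 / α)))
        = ∑' k : ℕ, ENNReal.ofReal (x ^ (k + 1) * Real.exp (-x) / k.factorial) *
            ENNReal.ofReal (v ^ (-(2 / α)) * (1 - v) ^ k) := by
    intro v hv
    have hv0 : 0 ≤ v ^ (-(2 / α)) := Real.rpow_nonneg hv.1.le _
    have hv1 : 0 ≤ 1 - v := by linarith [hv.2]
    have e : ∀ k : ℕ, ENNReal.ofReal (x ^ (k + 1) * Real.exp (-x) / k.factorial) *
            ENNReal.ofReal (v ^ (-(2 / α)) * (1 - v) ^ k)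
        = ENNReal.ofReal (x * Real.exp (-x) * v ^ (-(2 / α)) *
            ((x * (1 - v)) ^ k / k.factorial)) := by
      intro k
      rw [← ENNReal.ofReal_mul (by positivity)]
      congr 1
      rw [mul_pow]
      ring
    simp_rw [e]
    rw [← ENNReal.ofReal_tsum_of_nonneg (fun k => by positivity)
      ((Real.summable_pow_div_factorial _).mul_left _), tsum_mul_left]
    have : ∑' k : ℕ, (x * (1 - v)) ^ k / k.factorial = Real.exp (x * (1 - v)) := by
      rw [Real.exp_eq_exp_ℝ, NormedSpace.exp_eq_tsum_div]
    rw [this]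
    congr 1
    have : Real.exp (-(x * v)) = Real.exp (-x) * Real.exp (x * (1 - v)) := by
      rw [← Real.exp_add]; ring_nf
    rw [this]
    ring
  rw [setLIntegral_congr_fun measurableSet_Ioo h1, lintegral_tsum fun k => by fun_prop]
  congr 1
  funext k
  have hG : 0 < Real.Gamma (1 - 2 / α) := Real.Gamma_pos_of_pos (by linarith)
  rw [lintegral_const_mul _ (by fun_prop), lintegral_Ioo_beta hδ,
    ← ENNReal.ofReal_mul (by positivity)]
  congr 1
  have : (k.factorial : ℝ) ≠ 0 := by positivity
  field_simp

variable {ν : Measure ℝ}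

/-- A non-integrable function has Bochner integral `0` by convention, which contradicts mean one. -/
lemma IsFadingLaw.integrable_id (hν : IsFadingLaw ν) : Integrable (fun x : ℝ => x) ν := by
  by_contra h
  have := hν.mean_one
  rw [integral_undef h] at this
  exact zero_ne_one this

lemma IsFadingLaw.integrable_exp (hν : IsFadingLaw ν) {s : ℝ} (hs : 0 ≤ s) :
    Integrable (fun x : ℝ => Real.exp (-(s * x))) ν := by
  have := hν.prob
  refine Integrable.of_bound (C := 1) (by fun_prop) ?_
  filter_upwards [hν.nonneg] with x hx
  rw [Real.norm_eq_abs, Real.abs_exp, Real.exp_le_one_iff, neg_nonpos]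
  positivity

lemma IsFadingLaw.fadingMGF_le_one (hν : IsFadingLaw ν) {s : ℝ} (hs : 0 ≤ s) :
    fadingMGF ν s ≤ 1 := by
  have := hν.prob
  have h : ∫ x, Real.exp (-(s * x)) ∂ν ≤ ∫ _, (1 : ℝ) ∂ν := by
    refine integral_mono_ae (hν.integrable_exp hs) (integrable_const _) ?_
    filter_upwards [hν.nonneg] with x hx
    rw [Real.exp_le_one_iff, neg_nonpos]
    positivity
  simpa [fadingMGF] using h

lemma IsFadingLaw.fadingMGF_pos (hν : IsFadingLaw ν) {s : ℝ} (hs : 0 ≤ s) :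
    0 < fadingMGF ν s := by
  have := hν.prob
  exact integral_exp_pos (hν.integrable_exp hs)

lemma IsFadingLaw.ofReal_fadingMGF (hν : IsFadingLaw ν) {s : ℝ} (hs : 0 ≤ s) :
    ENNReal.ofReal (fadingMGF ν s) = ∫⁻ x, ENNReal.ofReal (Real.exp (-(s * x))) ∂ν :=
  ofReal_integral_eq_lintegral_ofReal (hν.integrable_exp hs)
    (Eventually.of_forall fun x => by positivity)

lemma IsFadingLaw.ofReal_one_sub_fadingMGF (hν : IsFadingLaw ν) {s : ℝ} (hs : 0 ≤ s) :
    ENNReal.ofReal (1 - fadingMGF ν s)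
      = ∫⁻ x, ENNReal.ofReal (1 - Real.exp (-(s * x))) ∂ν := by
  have := hν.prob
  have hi : Integrable (fun x => 1 - Real.exp (-(s * x))) ν :=
    (integrable_const _).sub (hν.integrable_exp hs)
  rw [← ofReal_integral_eq_lintegral_ofReal hi, integral_sub (integrable_const _) (hν.integrable_exp hs)]
  · simp [fadingMGF]
  · filter_upwards [hν.nonneg] with x hx
    simp only [Pi.zero_apply, sub_nonneg, Real.exp_le_one_iff, neg_nonpos]
    positivity

/-- From `1 - e^{-sx} ≤ sx` and mean one. It cancels the singularity `1/y` of the rate integrand at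
`0`. -/
lemma IsFadingLaw.one_sub_fadingMGF_le (hν : IsFadingLaw ν) {s : ℝ} (hs : 0 ≤ s) :
    1 - fadingMGF ν s ≤ s := by
  have := hν.prob
  have h : ∫ x, (1 - s * x) ∂ν ≤ fadingMGF ν s := by
    refine integral_mono ((integrable_const _).sub (hν.integrable_id.const_mul s))
      (hν.integrable_exp hs) fun x => ?_
    simp only
    linarith [Real.add_one_le_exp (-(s * x))]
  rw [integral_sub (integrable_const _) (hν.integrable_id.const_mul s), integral_const_mul,
    hν.mean_one] at h
  simp at h
  linarith

/-- The integrand is bounded because `(sx)^{k+1} / (k+1)! ≤ e^{sx}`, so no higher moments of the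
gain are required. -/
lemma IsFadingLaw.integrable_moment (hν : IsFadingLaw ν) {s : ℝ} (hs : 0 < s) (k : ℕ) :
    Integrable (fun x : ℝ => x ^ (k + 1) * Real.exp (-(s * x))) ν := by
  have := hν.prob
  refine Integrable.of_bound (C := (k + 1).factorial / s ^ (k + 1)) (by fun_prop) ?_
  filter_upwards [hν.nonneg] with x hx
  have h := Real.pow_div_factorial_le_exp (s * x) (by positivity) (k + 1)
  rw [Real.norm_eq_abs, abs_of_nonneg (by positivity), Real.exp_neg, ← div_eq_mul_inv,
    div_le_div_iff₀ (Real.exp_pos _) (by positivity)]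
  rw [div_le_iff₀ (by positivity), mul_pow] at h
  linarith

lemma IsFadingLaw.fadingTerm_nonneg (hν : IsFadingLaw ν) {α s : ℝ} (hα : 2 < α) (hs : 0 < s)
    (k : ℕ) : 0 ≤ fadingTerm ν α s k := by
  have hδ : 2 / α < 1 := by rw [div_lt_one (by linarith)]; exact hα
  have hG : 0 < Real.Gamma (2 - 2 / α + k) :=
    Real.Gamma_pos_of_pos (by have : (0 : ℝ) ≤ k := by positivity
                              linarith)
  have : 0 ≤ fadingMoment ν k s := by
    refine integral_nonneg_of_ae ?_
    filter_upwards [hν.nonneg] with x hx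
    simp only [Pi.zero_apply]
    positivity
  unfold fadingTerm
  positivity

lemma IsFadingLaw.ofReal_fadingTerm (hν : IsFadingLaw ν) {α s : ℝ} (hα : 2 < α) (hs : 0 < s)
    (k : ℕ) : ENNReal.ofReal (Real.Gamma (1 - 2 / α) * fadingTerm ν α s k)
      = ∫⁻ x, ENNReal.ofReal (Real.Gamma (1 - 2 / α) *
          ((s * x) ^ (k + 1) * Real.exp (-(s * x)) * (Real.Gamma (2 - 2 / α + k))⁻¹)) ∂ν := by
  have hδ : 2 / α < 1 := by rw [div_lt_one (by linarith)]; exact hα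
  have hG1 : 0 < Real.Gamma (1 - 2 / α) := Real.Gamma_pos_of_pos (by linarith)
  have hG : 0 < Real.Gamma (2 - 2 / α + k) :=
    Real.Gamma_pos_of_pos (by have : (0 : ℝ) ≤ k := by positivity
                              linarith)
  have e : ∀ x, Real.Gamma (1 - 2 / α) *
          ((s * x) ^ (k + 1) * Real.exp (-(s * x)) * (Real.Gamma (2 - 2 / α + k))⁻¹)
      = (Real.Gamma (1 - 2 / α) * s ^ (k + 1) * (Real.Gamma (2 - 2 / α + k))⁻¹) *
        (x ^ (k + 1) * Real.exp (-(s * x))) := by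
    intro x
    rw [mul_pow]
    ring
  simp_rw [e]
  rw [← ofReal_integral_eq_lintegral_ofReal ((hν.integrable_moment hs k).const_mul _),
    integral_const_mul, fadingTerm, fadingMoment]
  · congr 1
    ring
  · filter_upwards [hν.nonneg] with x hx
    simp only [Pi.zero_apply]
    positivity

/-- The identities for a deterministic gain, with `s * x` in place of `x`, averaged over `ν` by
Tonelli. -/
lemma IsFadingLaw.lintegral_add_eq_tsum (hν : IsFadingLaw ν) {α s : ℝ} (hα : 2 < α)
    (hs : 0 < s) :
    (∫⁻ u in Ioi 1, ENNReal.ofReal (1 - fadingMGF ν (s * u ^ (-(α / 2)))))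
      + ENNReal.ofReal (1 - fadingMGF ν s)
      = ∑' k, ENNReal.ofReal (Real.Gamma (1 - 2 / α) * fadingTerm ν α s k) := by
  have := hν.prob
  have h1 : ∀ u ∈ Ioi (1 : ℝ), ENNReal.ofReal (1 - fadingMGF ν (s * u ^ (-(α / 2))))
      = ∫⁻ x, ENNReal.ofReal (1 - Real.exp (-(s * x * u ^ (-(α / 2))))) ∂ν := by
    intro u hu
    have hu' : (1 : ℝ) < u := hu
    rw [hν.ofReal_one_sub_fadingMGF (by positivity)]
    refine lintegral_congr fun x => ?_
    ring_nf
  rw [setLIntegral_congr_fun measurableSet_Ioi h1, lintegral_lintegral_swap (by fun_prop),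
    hν.ofReal_one_sub_fadingMGF hs.le, ← lintegral_add_right _ (by fun_prop)]
  simp_rw [hν.ofReal_fadingTerm hα hs]
  rw [← lintegral_tsum fun k => by fun_prop]
  refine lintegral_congr_ae ?_
  filter_upwards [hν.nonneg] with x hx
  rw [lintegral_one_sub_exp_rpow hα (by positivity),
    lintegral_Ioo_exp_rpow_eq_tsum hα (by positivity)]

/-- For a gain `x` the series is the integral of `s x e^{-sxv} v^{-2/α}` over `(0,1)`. Dropping the
exponential bounds it by a constant times `x`, finite since `α > 2`, and the mean of `x` is one. -/
lemma IsFadingLaw.tsum_ne_top (hν : IsFadingLaw ν) {α s : ℝ} (hα : 2 < α)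
    (hs : 0 < s) :
    ∑' k, ENNReal.ofReal (Real.Gamma (1 - 2 / α) * fadingTerm ν α s k) ≠ ∞ := by
  have hδ : 2 / α < 1 := by rw [div_lt_one (by linarith)]; exact hα
  simp_rw [hν.ofReal_fadingTerm hα hs]
  rw [← lintegral_tsum fun k => by fun_prop]
  have hle : ∫⁻ x, ∑' k : ℕ, ENNReal.ofReal (Real.Gamma (1 - 2 / α) *
          ((s * x) ^ (k + 1) * Real.exp (-(s * x)) * (Real.Gamma (2 - 2 / α + k))⁻¹)) ∂ν
      ≤ ∫⁻ x, ENNReal.ofReal x * (ENNReal.ofReal s *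
          ENNReal.ofReal (Real.Gamma (1 - 2 / α) * (Nat.factorial 0) /
            Real.Gamma (2 - 2 / α + (0 : ℕ)))) ∂ν := by
    refine lintegral_mono_ae ?_
    filter_upwards [hν.nonneg] with x hx
    rw [← lintegral_Ioo_exp_rpow_eq_tsum hα (by positivity), ← mul_assoc, ← ENNReal.ofReal_mul hx,
      ← lintegral_Ioo_beta hδ, ← lintegral_const_mul _ (by fun_prop)]
    refine setLIntegral_mono (by fun_prop) fun v hv => ?_
    rw [← ENNReal.ofReal_mul (by positivity)]
    refine ENNReal.ofReal_le_ofReal ?_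
    have h1 : Real.exp (-(s * x * v)) ≤ 1 := by
      rw [Real.exp_le_one_iff, neg_nonpos]
      have := hv.1.le
      positivity
    have h2 : 0 ≤ v ^ (-(2 / α)) := Real.rpow_nonneg hv.1.le _
    have h3 : 0 ≤ s * x := by positivity
    rw [pow_zero, mul_one, mul_comm x s]
    exact mul_le_mul_of_nonneg_right (mul_le_of_le_one_right h3 h1) h2
  refine ne_top_of_le_ne_top ?_ hle
  rw [lintegral_mul_const _ (by fun_prop), ← ofReal_integral_eq_lintegral_ofReal hν.integrable_id
    hν.nonneg]
  exact ENNReal.mul_ne_top ENNReal.ofReal_ne_top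
    (ENNReal.mul_ne_top ENNReal.ofReal_ne_top ENNReal.ofReal_ne_top)

lemma summable_of_tsum_ofReal_ne_top {f : ℕ → ℝ} (h0 : ∀ k, 0 ≤ f k)
    (h : ∑' k, ENNReal.ofReal (f k) ≠ ∞) : Summable f := by
  have := ENNReal.summable_toReal h
  simpa [ENNReal.toReal_ofReal (h0 _)] using this

lemma IsFadingLaw.summable_fadingTerm (hν : IsFadingLaw ν) {α s : ℝ} (hα : 2 < α)
    (hs : 0 < s) : Summable (fadingTerm ν α s) := by
  have hδ : 2 / α < 1 := by rw [div_lt_one (by linarith)]; exact hα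
  have hG1 : 0 < Real.Gamma (1 - 2 / α) := Real.Gamma_pos_of_pos (by linarith)
  have := summable_of_tsum_ofReal_ne_top
    (fun k => mul_nonneg hG1.le (hν.fadingTerm_nonneg hα hs k)) (hν.tsum_ne_top hα hs)
  exact (summable_mul_left_iff hG1.ne').1 this

lemma IsFadingLaw.lintegral_add_eq_fadingT (hν : IsFadingLaw ν) {α s : ℝ} (hα : 2 < α)
    (hs : 0 < s) :
    (∫⁻ u in Ioi 1, ENNReal.ofReal (1 - fadingMGF ν (s * u ^ (-(α / 2)))))
      + ENNReal.ofReal (1 - fadingMGF ν s) = ENNReal.ofReal (fadingT ν α s) := by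
  have hδ : 2 / α < 1 := by rw [div_lt_one (by linarith)]; exact hα
  have hG1 : 0 < Real.Gamma (1 - 2 / α) := Real.Gamma_pos_of_pos (by linarith)
  rw [hν.lintegral_add_eq_tsum hα hs, fadingT, ← tsum_mul_left,
    ENNReal.ofReal_tsum_of_nonneg (fun k => mul_nonneg hG1.le (hν.fadingTerm_nonneg hα hs k))
      ((hν.summable_fadingTerm hα hs).mul_left _)]

/-- The difference of the two sides is a nonnegative integral. This is what keeps `Z` bounded away
from zero. -/
lemma IsFadingLaw.one_sub_le_fadingT (hν : IsFadingLaw ν) {α s : ℝ} (hα : 2 < α)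
    (hs : 0 < s) : 1 - fadingMGF ν s ≤ fadingT ν α s := by
  have h := hν.lintegral_add_eq_fadingT hα hs
  have h1 : ENNReal.ofReal (1 - fadingMGF ν s) ≤ ENNReal.ofReal (fadingT ν α s) := by
    rw [← h]; exact le_add_left le_rfl
  have hT : 0 ≤ fadingT ν α s := by
    have hδ : 2 / α < 1 := by rw [div_lt_one (by linarith)]; exact hα
    exact mul_nonneg (Real.Gamma_pos_of_pos (by linarith)).le
      (tsum_nonneg fun k => hν.fadingTerm_nonneg hα hs k)
  exact (ENNReal.ofReal_le_ofReal_iff hT).1 h1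

lemma IsFadingLaw.lintegral_Ioi_one_sub (hν : IsFadingLaw ν) {α s : ℝ} (hα : 2 < α)
    (hs : 0 < s) :
    ∫⁻ u in Ioi 1, ENNReal.ofReal (1 - fadingMGF ν (s * u ^ (-(α / 2))))
      = ENNReal.ofReal (fadingMGF ν s - 1 + fadingT ν α s) := by
  have h := hν.lintegral_add_eq_fadingT hα hs
  rw [ENNReal.eq_sub_of_add_eq ENNReal.ofReal_ne_top h,
    ← ENNReal.ofReal_sub _ (sub_nonneg.2 (hν.fadingMGF_le_one hs.le))]
  congr 1
  ring

lemma measurable_fadingMGF [SFinite ν] : Measurable (fadingMGF ν) := by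
  have : StronglyMeasurable fun z : ℝ × ℝ => Real.exp (-(z.1 * z.2)) :=
    Measurable.stronglyMeasurable (by fun_prop)
  exact (this.integral_prod_right (ν := ν)).measurable

lemma measurable_fadingMoment [SFinite ν] (k : ℕ) : Measurable (fadingMoment ν k) := by
  have : StronglyMeasurable fun z : ℝ × ℝ => z.2 ^ (k + 1) * Real.exp (-(z.1 * z.2)) :=
    Measurable.stronglyMeasurable (by fun_prop)
  exact (this.integral_prod_right (ν := ν)).measurable

lemma measurable_fadingT [SFinite ν] (α : ℝ) : Measurable (fadingT ν α) := by
  unfold fadingT fadingTerm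
  refine Measurable.const_mul (Measurable.tsum fun k => ?_) _
  exact ((measurable_id.pow_const _).mul (measurable_fadingMoment k)).mul_const _

lemma IsFadingLaw.antitoneOn_fadingMGF (hν : IsFadingLaw ν) :
    AntitoneOn (fadingMGF ν) (Ici 0) := by
  intro s hs t ht hst
  refine integral_mono_ae (hν.integrable_exp ht) (hν.integrable_exp hs) ?_
  filter_upwards [hν.nonneg] with x hx
  gcongr

lemma IsFadingLaw.continuousOn_fadingMGF (hν : IsFadingLaw ν) :
    ContinuousOn (fadingMGF ν) (Ici 0) := by
  have := hν.prob
  refine continuousOn_of_dominated (bound := fun _ => 1) (fun s hs => by fun_prop) ?_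
    (integrable_const _) (Eventually.of_forall fun x => by fun_prop)
  intro s hs
  filter_upwards [hν.nonneg] with x hx
  have : (0 : ℝ) ≤ s := hs
  rw [Real.norm_eq_abs, Real.abs_exp, Real.exp_le_one_iff, neg_nonpos]
  positivity

end Fading

/-! The inner integral -/

section Inner

variable {a y p : ℝ}

lemma integrableOn_exp_mul_exp_rpow (ha : 0 < a) (hy : 0 < y) :
    IntegrableOn (fun ξ : ℝ => Real.exp (-(a * ξ)) * Real.exp (-(y * ξ ^ p))) (Ioi 0) := by
  refine Integrable.mono' (integrableOn_exp_mul_Ioi (a := -a) (by linarith) 0)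
    (Measurable.aestronglyMeasurable (by fun_prop)) ?_
  filter_upwards [ae_restrict_mem measurableSet_Ioi] with ξ hξ
  have : (0 : ℝ) < ξ := hξ
  rw [Real.norm_eq_abs, abs_of_nonneg (by positivity), neg_mul]
  refine mul_le_of_le_one_right (by positivity) ?_
  rw [Real.exp_le_one_iff, neg_nonpos]
  positivity

lemma integrableOn_rpow_mul_exp_mul_exp_rpow (ha : 0 < a) (hy : 0 < y) (hp : 0 < p) :
    IntegrableOn (fun ξ : ℝ => ξ ^ (p - 1) * Real.exp (-(a * ξ)) * Real.exp (-(y * ξ ^ p)))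
      (Ioi 0) := by
  have h := integrableOn_rpow_mul_exp_neg_mul_rpow (p := 1) (s := p - 1) (b := a)
    (by linarith) one_pos ha
  refine Integrable.mono' h (Measurable.aestronglyMeasurable (by fun_prop)) ?_
  filter_upwards [ae_restrict_mem measurableSet_Ioi] with ξ hξ
  have : (0 : ℝ) < ξ := hξ
  rw [Real.norm_eq_abs, abs_of_nonneg (by positivity), neg_mul, Real.rpow_one]
  refine mul_le_of_le_one_right (by positivity) ?_
  rw [Real.exp_le_one_iff, neg_nonpos]
  positivity

/-- The function `-e^{-aξ} e^{-yξ^p}` increases from `-1` to `0` on the half-line, and its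
derivative is the sum of the two integrands. -/
lemma integral_exp_mul_exp_rpow (ha : 0 < a) (hy : 0 < y) (hp : 0 < p) :
    a * (∫ ξ in Ioi 0, Real.exp (-(a * ξ)) * Real.exp (-(y * ξ ^ p)))
      = 1 - p * y * ∫ ξ in Ioi 0,
          ξ ^ (p - 1) * Real.exp (-(a * ξ)) * Real.exp (-(y * ξ ^ p)) := by
  have hi1 := (integrableOn_exp_mul_exp_rpow (p := p) ha hy).const_mul a
  have hi2 := (integrableOn_rpow_mul_exp_mul_exp_rpow ha hy hp).const_mul (p * y)
  have hc : Continuous fun ξ : ℝ => ξ ^ p := Real.continuous_rpow_const hp.le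
  have h := integral_Ioi_of_hasDerivAt_of_tendsto
    (f := fun ξ : ℝ => -(Real.exp (-(a * ξ)) * Real.exp (-(y * ξ ^ p))))
    (f' := fun ξ => a * (Real.exp (-(a * ξ)) * Real.exp (-(y * ξ ^ p)))
      + p * y * (ξ ^ (p - 1) * Real.exp (-(a * ξ)) * Real.exp (-(y * ξ ^ p))))
    (a := 0) (m := 0) (Continuous.continuousWithinAt (by fun_prop)) ?_ (hi1.add hi2) ?_
  · rw [integral_add hi1 hi2, integral_const_mul, integral_const_mul] at h
    simp [Real.zero_rpow hp.ne'] at h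
    linarith
  · intro ξ hξ
    have hξ' : (0 : ℝ) < ξ := hξ
    have d1 := ((hasDerivAt_id' ξ).const_mul a).fun_neg.exp
    have d2 := ((Real.hasDerivAt_rpow_const (p := p) (Or.inl hξ'.ne')).const_mul y).fun_neg.exp
    exact (d1.fun_mul d2).fun_neg.congr_deriv (by ring)
  · rw [← neg_zero]
    refine Tendsto.neg ?_
    have h1 : Tendsto (fun ξ : ℝ => Real.exp (-(a * ξ))) atTop (𝓝 0) :=
      Real.tendsto_exp_neg_atTop_nhds_zero.comp (tendsto_id.const_mul_atTop ha)
    refine squeeze_zero' (Eventually.of_forall fun ξ => by positivity) ?_ h1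
    filter_upwards [eventually_ge_atTop 0] with ξ hξ
    refine mul_le_of_le_one_right (by positivity) ?_
    rw [Real.exp_le_one_iff, neg_nonpos]
    positivity

end Inner

/-! ### Bounds on `Z` and `G`, and integrability of the rate integrand -/

namespace Network

variable {T : ℕ} {N : Network T} {t : Fin T} {y : ℝ}

/-- The argument at which the transforms of the interfering gains are evaluated. -/
noncomputable def interfArg (N : Network T) (t q : Fin T) (y : ℝ) : ℝ :=
  (N.ratio t q)⁻¹ * N.snr q * y

lemma Admissible.snr_pos (hN : N.Admissible) (q : Fin T) : 0 < N.snr q :=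
  div_pos (hN.power_pos q) hN.noise_pos

lemma Admissible.ratio_pos (hN : N.Admissible) (t q : Fin T) : 0 < N.ratio t q :=
  mul_pos (div_pos (hN.power_pos q) (hN.power_pos t)) (div_pos (hN.bias_pos q) (hN.bias_pos t))

lemma Admissible.interfArg_pos (hN : N.Admissible) (t q : Fin T) (hy : 0 < y) :
    0 < N.interfArg t q y :=
  mul_pos (mul_pos (inv_pos.2 (hN.ratio_pos t q)) (hN.snr_pos q)) hy

lemma Admissible.one_le_bands_real (hN : N.Admissible) (q : Fin T) : (1 : ℝ) ≤ N.bands q := by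
  exact_mod_cast hN.one_le_bands q

lemma Admissible.reuseDensity_pos (hN : N.Admissible) (q : Fin T) : 0 < N.reuseDensity q :=
  div_pos (hN.density_pos q) (lt_of_lt_of_le one_pos (hN.one_le_bands_real q))

/-- The group `M - 1 + T_I` is isolated because it is the integral of `lintegral_Ioi_one_sub`, hence
nonnegative. -/
lemma pairZ_eq (N : Network T) (t q : Fin T) (y : ℝ) :
    N.pairZ t q y = N.ratio t q ^ (2 / N.alpha) * (N.bands q +
      (fadingMGF (N.interfLaw q) (N.interfArg t q y) - 1
        + fadingT (N.interfLaw q) N.alpha (N.interfArg t q y))) := by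
  unfold pairZ interfArg
  ring

lemma Admissible.le_pairZ (hN : N.Admissible) (t q : Fin T) (hy : 0 < y) :
    N.ratio t q ^ (2 / N.alpha) ≤ N.pairZ t q y := by
  have h := (hN.interfLaw_fading q).one_sub_le_fadingT hN.two_lt_alpha (hN.interfArg_pos t q hy)
  have h1 := hN.one_le_bands_real q
  have h2 : 0 ≤ N.ratio t q ^ (2 / N.alpha) := Real.rpow_nonneg (hN.ratio_pos t q).le _
  rw [pairZ_eq]
  exact le_mul_of_one_le_right h2 (by linarith)

lemma Admissible.pairZ_pos (hN : N.Admissible) (t q : Fin T) (hy : 0 < y) :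
    0 < N.pairZ t q y :=
  (Real.rpow_pos_of_pos (hN.ratio_pos t q) _).trans_le (hN.le_pairZ t q hy)

lemma Admissible.ratio_self (hN : N.Admissible) (t : Fin T) : N.ratio t t = 1 := by
  rw [ratio, div_self (hN.power_pos t).ne', div_self (hN.bias_pos t).ne', one_mul]

/-- The term `q = t` alone is at least `1`, because the ratio of a tier to itself is `1`; the others
are positive. -/
lemma Admissible.one_le_tierZ (hN : N.Admissible) (t : Fin T) (hy : 0 < y) :
    1 ≤ N.tierZ N.reuseDensity t y := by
  have h1 : 1 ≤ N.pairZ t t y := by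
    have := hN.le_pairZ t t hy
    rwa [hN.ratio_self, Real.one_rpow] at this
  refine h1.trans ?_
  have h2 := Finset.single_le_sum (f := fun q => N.reuseDensity q / N.reuseDensity t *
    N.pairZ t q y) (fun q _ => mul_nonneg (div_pos (hN.reuseDensity_pos q)
      (hN.reuseDensity_pos t)).le (hN.pairZ_pos t q hy).le) (Finset.mem_univ t)
  simp only [div_self (hN.reuseDensity_pos t).ne', one_mul] at h2
  exact h2

lemma Admissible.decay_pos (hN : N.Admissible) (t : Fin T) (hy : 0 < y) :
    0 < Real.pi * N.reuseDensity t * N.tierZ N.reuseDensity t y :=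
  mul_pos (mul_pos Real.pi_pos (hN.reuseDensity_pos t))
    (one_pos.trans_le (hN.one_le_tierZ t hy))

/-- Undoes the integration by parts: this is the form in which `G` arises from averaging over the
serving distance. -/
lemma Admissible.tierG_eq (hN : N.Admissible) (t : Fin T) (hy : 0 < y) :
    N.tierG N.reuseDensity t y = Real.pi * N.reuseDensity t * ∫ ξ in Ioi 0,
      Real.exp (-(Real.pi * N.reuseDensity t * N.tierZ N.reuseDensity t y * ξ))
        * Real.exp (-(y * ξ ^ (N.alpha / 2))) := by
  have hα := hN.two_lt_alpha
  have h := integral_exp_mul_exp_rpow (p := N.alpha / 2) (hN.decay_pos t hy) hy (by linarith)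
  have hZ : 0 < N.tierZ N.reuseDensity t y := one_pos.trans_le (hN.one_le_tierZ t hy)
  rw [tierG]
  unfold innerIntegrand
  set J := ∫ ξ in Ioi (0 : ℝ), ξ ^ (N.alpha / 2 - 1) * Real.exp (-(Real.pi * N.reuseDensity t
      * N.tierZ N.reuseDensity t y * ξ)) * Real.exp (-(y * ξ ^ (N.alpha / 2)))
  set I := ∫ ξ in Ioi (0 : ℝ), Real.exp (-(Real.pi * N.reuseDensity t
      * N.tierZ N.reuseDensity t y * ξ)) * Real.exp (-(y * ξ ^ (N.alpha / 2)))
  field_simp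
  linarith

lemma Admissible.tierG_nonneg (hN : N.Admissible) (t : Fin T) (hy : 0 < y) :
    0 ≤ N.tierG N.reuseDensity t y := by
  have := hN.reuseDensity_pos t
  rw [hN.tierG_eq t hy]
  have : 0 ≤ ∫ ξ in Ioi (0 : ℝ), Real.exp (-(Real.pi * N.reuseDensity t
      * N.tierZ N.reuseDensity t y * ξ)) * Real.exp (-(y * ξ ^ (N.alpha / 2))) :=
    integral_nonneg fun ξ => by positivity
  positivity

lemma Admissible.ofReal_tierG (hN : N.Admissible) (t : Fin T) (hy : 0 < y) :
    ENNReal.ofReal (N.tierG N.reuseDensity t y) =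
      ∫⁻ ξ in Ioi 0, ENNReal.ofReal (Real.pi * N.reuseDensity t) * ENNReal.ofReal
        (Real.exp (-(Real.pi * N.reuseDensity t * N.tierZ N.reuseDensity t y * ξ))
        * Real.exp (-(y * ξ ^ (N.alpha / 2)))) := by
  have := hN.reuseDensity_pos t
  rw [hN.tierG_eq t hy, ENNReal.ofReal_mul (by positivity), ofReal_integral_eq_lintegral_ofReal
    (integrableOn_exp_mul_exp_rpow (hN.decay_pos t hy) hy)
    (Eventually.of_forall fun ξ => by positivity), lintegral_const_mul _ (by fun_prop)]

lemma Admissible.tierG_le_one (hN : N.Admissible) (t : Fin T) (hy : 0 < y) :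
    N.tierG N.reuseDensity t y ≤ 1 := by
  have hZ := hN.one_le_tierZ t hy
  have hα := hN.two_lt_alpha
  have hJ : 0 ≤ ∫ ξ in Ioi (0 : ℝ), N.innerIntegrand N.reuseDensity t y ξ := by
    refine setIntegral_nonneg measurableSet_Ioi fun ξ hξ => ?_
    have : (0 : ℝ) < ξ := hξ
    unfold innerIntegrand
    positivity
  have h1 : 1 / N.tierZ N.reuseDensity t y ≤ 1 := by
    rw [div_le_one (by linarith)]; exact hZ
  have h2 : 0 ≤ N.alpha / 2 * (y / N.tierZ N.reuseDensity t y) *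
      ∫ ξ in Ioi (0 : ℝ), N.innerIntegrand N.reuseDensity t y ξ := by positivity
  rw [tierG]
  linarith

/-- Dropping the factor `exp(-πλ' Z ξ)` leaves a Gamma integral, of order `y^{-2/α}`. This is the
decay used at infinity. -/
lemma Admissible.tierG_le_rpow (hN : N.Admissible) (t : Fin T) (hy : 0 < y) :
    N.tierG N.reuseDensity t y ≤ Real.pi * N.reuseDensity t *
      (y ^ (-1 / (N.alpha / 2)) * Real.Gamma (1 / (N.alpha / 2) + 1)) := by
  have hα := hN.two_lt_alpha
  have hl := hN.reuseDensity_pos t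
  rw [hN.tierG_eq t hy, ← integral_exp_neg_mul_rpow (by linarith) hy]
  refine mul_le_mul_of_nonneg_left ?_ (by positivity)
  have hi := integrableOn_rpow_mul_exp_neg_mul_rpow (p := N.alpha / 2) (s := 0) (b := y)
    (by linarith) (by linarith) hy
  simp only [Real.rpow_zero, one_mul] at hi
  refine setIntegral_mono_on (integrableOn_exp_mul_exp_rpow (hN.decay_pos t hy) hy) hi
    measurableSet_Ioi fun ξ hξ => ?_
  rw [neg_mul]
  refine mul_le_of_le_one_left (by positivity) ?_
  rw [Real.exp_le_one_iff, neg_nonpos]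
  exact mul_nonneg (hN.decay_pos t hy).le (le_of_lt hξ)

lemma Admissible.measurable_tierG (hN : N.Admissible) (t : Fin T) :
    Measurable (N.tierG N.reuseDensity t) := by
  have hZ : Measurable (N.tierZ N.reuseDensity t) := by
    unfold tierZ pairZ
    refine Finset.measurable_sum _ fun q _ => Measurable.const_mul ?_ _
    have := (hN.interfLaw_fading q).prob
    have h1 := (measurable_fadingMGF (ν := N.interfLaw q)).comp
      (measurable_const_mul ((N.ratio t q)⁻¹ * N.snr q))
    have h2 := (measurable_fadingT (ν := N.interfLaw q) N.alpha).comp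
      (measurable_const_mul ((N.ratio t q)⁻¹ * N.snr q))
    exact (measurable_const.add (h1.const_mul _)).add (h2.const_mul _)
  have hJ : Measurable fun y => ∫ ξ in Ioi (0 : ℝ), N.innerIntegrand N.reuseDensity t y ξ := by
    have : StronglyMeasurable fun z : ℝ × ℝ => N.innerIntegrand N.reuseDensity t z.1 z.2 := by
      unfold innerIntegrand
      refine Measurable.stronglyMeasurable ?_
      have hZ' : Measurable fun z : ℝ × ℝ => N.tierZ N.reuseDensity t z.1 :=
        hZ.comp measurable_fst
      fun_prop
    exact (this.integral_prod_right (ν := volume.restrict (Ioi 0))).measurable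
  unfold tierG
  fun_prop

lemma Admissible.outerIntegrand_nonneg (hN : N.Admissible) (t : Fin T) (hy : 0 < y) :
    0 ≤ N.outerIntegrand N.reuseDensity t y := by
  have h := (hN.servLaw_fading t).fadingMGF_le_one (mul_pos (hN.snr_pos t) hy).le
  have := hN.tierG_nonneg t hy
  exact mul_nonneg (by linarith) (by positivity)

/-- On `(0, 1]` the bounds `1 - M ≤ SNR_t y` and `G ≤ 1` make the integrand bounded. Beyond `1`, the
bounds `1 - M ≤ 1` and `G = O(y^{-2/α})` give an integrable power `y^{-2/α - 1}`. -/
lemma Admissible.integrableOn_outerIntegrand (hN : N.Admissible) (t : Fin T) :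
    IntegrableOn (N.outerIntegrand N.reuseDensity t) (Ioi 0) := by
  have hα := hN.two_lt_alpha
  have hl := hN.reuseDensity_pos t
  have hm : Measurable (N.outerIntegrand N.reuseDensity t) := by
    have := (hN.servLaw_fading t).prob
    have h1 := (measurable_fadingMGF (ν := N.servLaw t)).comp (measurable_const_mul (N.snr t))
    have h2 := hN.measurable_tierG t
    exact (measurable_const.sub h1).mul (h2.div measurable_id)
  rw [← Ioc_union_Ioi_eq_Ioi zero_le_one]
  refine IntegrableOn.union ?_ ?_
  · refine Integrable.mono' (g := fun _ => N.snr t) (integrableOn_const (by simp))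
      hm.aestronglyMeasurable ?_
    filter_upwards [ae_restrict_mem measurableSet_Ioc] with y hy
    have hy0 : 0 < y := hy.1
    rw [Real.norm_eq_abs, abs_of_nonneg (hN.outerIntegrand_nonneg t hy0)]
    have h1 := (hN.servLaw_fading t).one_sub_fadingMGF_le (mul_pos (hN.snr_pos t) hy0).le
    have h2 := hN.tierG_le_one t hy0
    have h3 := hN.tierG_nonneg t hy0
    have hs := hN.snr_pos t
    calc N.outerIntegrand N.reuseDensity t y
        ≤ (N.snr t * y) * (1 / y) := by
          unfold outerIntegrand
          gcongr
      _ = N.snr t := by field_simp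
  · set C := Real.pi * N.reuseDensity t * Real.Gamma (1 / (N.alpha / 2) + 1) with hC
    have hneg : -1 / (N.alpha / 2) - 1 < -1 := by
      have : -1 / (N.alpha / 2) < 0 := div_neg_of_neg_of_pos (by norm_num) (by linarith)
      linarith
    refine Integrable.mono' (g := fun y => C * y ^ (-1 / (N.alpha / 2) - 1))
      ((integrableOn_Ioi_rpow_of_lt hneg one_pos).const_mul _) hm.aestronglyMeasurable ?_
    filter_upwards [ae_restrict_mem measurableSet_Ioi] with y hy
    have hy0 : 0 < y := one_pos.trans hy
    rw [Real.norm_eq_abs, abs_of_nonneg (hN.outerIntegrand_nonneg t hy0)]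
    have h1 := ((hN.servLaw_fading t).fadingMGF_pos (mul_pos (hN.snr_pos t) hy0).le).le
    have h2 := hN.tierG_le_rpow t hy0
    have h3 := hN.tierG_nonneg t hy0
    calc N.outerIntegrand N.reuseDensity t y
        ≤ 1 * (Real.pi * N.reuseDensity t *
      (y ^ (-1 / (N.alpha / 2)) * Real.Gamma (1 / (N.alpha / 2) + 1)) / y) := by
          unfold outerIntegrand
          gcongr
          linarith
      _ = C * y ^ (-1 / (N.alpha / 2) - 1) := by
          rw [Real.rpow_sub_one hy0.ne']
          ring

end Network

/-! Independence -/

section Independence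

variable {Ω : Type*} [mΩ : MeasurableSpace Ω] {μ : Measure Ω}

/-- The joint law is a product, so one variable may be frozen while the other is averaged. This
plays the role of conditioning throughout. -/
lemma ProbabilityTheory.IndepFun.lintegral_eq [IsFiniteMeasure μ] {A B : Type*}
    [MeasurableSpace A] [MeasurableSpace B] {X : Ω → A} {Y : Ω → B} (h : IndepFun X Y μ)
    (hX : Measurable X) (hY : Measurable Y) {F : A × B → ℝ≥0∞} (hF : Measurable F) :
    ∫⁻ ω, F (X ω, Y ω) ∂μ = ∫⁻ ω, ∫⁻ ω', F (X ω, Y ω') ∂μ ∂μ := by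
  have h1 := (indepFun_iff_map_prod_eq_prod_map_map hX.aemeasurable hY.aemeasurable).1 h
  rw [← lintegral_map (f := F) (g := fun ω => (X ω, Y ω)) hF (hX.prodMk hY), h1,
    lintegral_prod _ hF.aemeasurable, lintegral_map hF.lintegral_prod_right' hX]
  refine lintegral_congr fun ω => ?_
  rw [lintegral_map (f := fun b => F (X ω, b)) (hF.comp measurable_prodMk_left) hY]

variable {ι κ : Type*} {m : ι → MeasurableSpace Ω}

lemma ProbabilityTheory.iIndep.indepFun_of_disjoint (hm : iIndep m μ) (hle : ∀ i, m i ≤ mΩ)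
    {S S' : Set ι} (hS : Disjoint S S') {A B : Type*}
    [MeasurableSpace A] [MeasurableSpace B] {X : Ω → A} {Y : Ω → B}
    (hX : Measurable[⨆ i ∈ S, m i] X) (hY : Measurable[⨆ i ∈ S', m i] Y) : IndepFun X Y μ :=
  indep_of_indep_of_le_left (indep_of_indep_of_le_right
    (indep_iSup_of_disjoint hle hm hS) hY.comap_le) hX.comap_le

lemma ProbabilityTheory.iIndep.lintegral_prod_eq (hm : iIndep m μ) (hle : ∀ i, m i ≤ mΩ)
    {S : κ → Set ι} (hS : Pairwise (Function.onFun Disjoint S)) {f : κ → Ω → ℝ≥0∞}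
    (hf : ∀ k, Measurable[⨆ i ∈ S k, m i] (f k)) (s : Finset κ) :
    ∫⁻ ω, ∏ k ∈ s, f k ω ∂μ = ∏ k ∈ s, ∫⁻ ω, f k ω ∂μ := by
  classical
  have := hm.isProbabilityMeasure
  induction s using Finset.induction_on with
  | empty => simp
  | insert a s ha ih =>
    simp_rw [Finset.prod_insert ha]
    rw [← ih]
    have hdis : Disjoint (S a) (⋃ k ∈ s, S k) := by
      simp only [disjoint_iUnion_right]
      intro k hk
      exact hS fun h => ha (h ▸ hk)
    refine lintegral_mul_eq_lintegral_mul_lintegral_of_independent_measurableSpace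
      (iSup₂_le fun i _ => hle i) (iSup₂_le fun i _ => hle i)
      (indep_iSup_of_disjoint hle hm hdis) (hf a) ?_
    refine Finset.measurable_prod s fun k hk => (hf k).mono ?_ le_rfl
    exact biSup_mono fun i hi => mem_biUnion hk hi

/-- The finite case is multiplicativity of expectations; since `expNeg` is continuous and bounded by
`1`, the limit over finite sets passes through the integral. -/
lemma ProbabilityTheory.iIndep.lintegral_expNeg_tsum [Countable κ] (hm : iIndep m μ)
    (hle : ∀ i, m i ≤ mΩ) {S : κ → Set ι} (hS : Pairwise (Function.onFun Disjoint S))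
    {f : κ → Ω → ℝ≥0∞} (hf : ∀ k, Measurable[⨆ i ∈ S k, m i] (f k)) {c : κ → ℝ≥0∞}
    (hc : ∀ k, ∫⁻ ω, expNeg (f k ω) ∂μ = expNeg (c k)) :
    ∫⁻ ω, expNeg (∑' k, f k ω) ∂μ = expNeg (∑' k, c k) := by
  have := hm.isProbabilityMeasure
  have hf' : ∀ k, Measurable (f k) := fun k => (hf k).mono (iSup₂_le fun i _ => hle i) le_rfl
  have h1 : Tendsto (fun s : Finset κ => ∫⁻ ω, expNeg (∑ k ∈ s, f k ω) ∂μ) atTop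
      (𝓝 (∫⁻ ω, expNeg (∑' k, f k ω) ∂μ)) := by
    refine tendsto_lintegral_filter_of_dominated_convergence (fun _ => 1)
      (Eventually.of_forall fun s => ?_)
      (Eventually.of_forall fun n => Eventually.of_forall fun ω => expNeg_le_one _) (by simp) ?_
    · exact measurable_expNeg.comp (Finset.measurable_sum s fun k _ => hf' k)
    · exact Eventually.of_forall fun ω =>
        (continuous_expNeg.tendsto _).comp ENNReal.summable.hasSum
  have h2 : Tendsto (fun s : Finset κ => expNeg (∑ k ∈ s, c k)) atTop
      (𝓝 (expNeg (∑' k, c k))) :=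
    (continuous_expNeg.tendsto _).comp ENNReal.summable.hasSum
  refine tendsto_nhds_unique h1 (h2.congr fun s => ?_)
  simp_rw [expNeg_sum, ← hc]
  exact (hm.lintegral_prod_eq hle hS (f := fun k ω => expNeg (f k ω))
    (fun k => measurable_expNeg.comp (hf k)) s).symm

end Independence

/-! The exponents attached to the interfering base stations -/

namespace Network

variable {T : ℕ} {N : Network T} {t : Fin T} {y : ℝ}

/-- Laplace transform of the contribution to the interference of a base station of tier `q` at
squared distance `x`, normalised by the squared distance `r` of the serving base station. -/
noncomputable def stationMGF (N : Network T) (q : Fin T) (y r x : ℝ) : ℝ :=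
  1 - (1 - fadingMGF (N.interfLaw q) (y * N.snr q * (r / x) ^ (N.alpha / 2))) / N.bands q

/-- The exponent of `stationMGF`. -/
noncomputable def stationExponent (N : Network T) (q : Fin T) (y r x : ℝ) : ℝ≥0∞ :=
  ENNReal.ofReal (-Real.log (N.stationMGF q y r x))

/-- The factor by which the squared distance of the serving base station is multiplied to obtain
the squared exclusion radius of tier `q`. -/
noncomputable def exclusion (N : Network T) (t q : Fin T) : ℝ := N.ratio t q ^ (2 / N.alpha)

lemma Admissible.exclusion_pos (hN : N.Admissible) (t q : Fin T) : 0 < N.exclusion t q :=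
  Real.rpow_pos_of_pos (hN.ratio_pos t q) _

lemma Admissible.exclusion_self (hN : N.Admissible) (t : Fin T) : N.exclusion t t = 1 := by
  rw [exclusion, hN.ratio_self, Real.one_rpow]

lemma Admissible.exclusion_rpow (hN : N.Admissible) (t q : Fin T) :
    N.exclusion t q ^ (N.alpha / 2) = N.ratio t q := by
  have := hN.two_lt_alpha
  rw [exclusion, ← Real.rpow_mul (hN.ratio_pos t q).le,
    show 2 / N.alpha * (N.alpha / 2) = 1 by field_simp, Real.rpow_one]

variable {r x : ℝ}

lemma Admissible.stationArg_nonneg (hN : N.Admissible) (q : Fin T) (hy : 0 < y) (hr : 0 ≤ r)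
    (hx : 0 < x) : 0 ≤ y * N.snr q * (r / x) ^ (N.alpha / 2) := by
  have := hN.snr_pos q
  positivity

lemma Admissible.stationMGF_pos (hN : N.Admissible) (q : Fin T) (hy : 0 < y) (hr : 0 ≤ r)
    (hx : 0 < x) : 0 < N.stationMGF q y r x := by
  have h := (hN.interfLaw_fading q).fadingMGF_pos (hN.stationArg_nonneg q hy hr hx)
  have h1 := hN.one_le_bands_real q
  rw [stationMGF, sub_pos, div_lt_one (by linarith)]
  linarith

lemma Admissible.stationMGF_le_one (hN : N.Admissible) (q : Fin T) (hy : 0 < y) (hr : 0 ≤ r)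
    (hx : 0 < x) : N.stationMGF q y r x ≤ 1 := by
  have h := (hN.interfLaw_fading q).fadingMGF_le_one (hN.stationArg_nonneg q hy hr hx)
  have h1 := hN.one_le_bands_real q
  rw [stationMGF, sub_le_self_iff]
  exact div_nonneg (by linarith) (by linarith)

lemma Admissible.expNeg_stationExponent (hN : N.Admissible) (q : Fin T) (hy : 0 < y) (hr : 0 ≤ r)
    (hx : 0 < x) : expNeg (N.stationExponent q y r x) = ENNReal.ofReal (N.stationMGF q y r x) := by
  have h0 := hN.stationMGF_pos q hy hr hx
  have h1 := hN.stationMGF_le_one q hy hr hx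
  rw [stationExponent, expNeg_ofReal (neg_nonneg.2 (Real.log_nonpos h0.le h1)), neg_neg,
    Real.exp_log h0]

lemma Admissible.one_sub_expNeg_stationExponent (hN : N.Admissible) (q : Fin T) (hy : 0 < y)
    (hr : 0 ≤ r) (hx : 0 < x) : 1 - expNeg (N.stationExponent q y r x) = ENNReal.ofReal
      ((1 - fadingMGF (N.interfLaw q) (y * N.snr q * (r / x) ^ (N.alpha / 2))) / N.bands q) := by
  rw [hN.expNeg_stationExponent q hy hr hx, ← ENNReal.ofReal_one,
    ← ENNReal.ofReal_sub _ (hN.stationMGF_pos q hy hr hx).le, stationMGF, sub_sub_cancel]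

lemma Admissible.measurable_stationExponent (hN : N.Admissible) (q : Fin T) (y : ℝ)
    {A : Type*} [MeasurableSpace A] {f g : A → ℝ} (hf : Measurable f) (hg : Measurable g) :
    Measurable fun z => N.stationExponent q y (f z) (g z) := by
  have := (hN.interfLaw_fading q).prob
  have h : Measurable fun z =>
      fadingMGF (N.interfLaw q) (y * N.snr q * (f z / g z) ^ (N.alpha / 2)) :=
    measurable_fadingMGF.comp (by fun_prop)
  unfold stationExponent stationMGF
  fun_prop

lemma Admissible.continuousOn_stationExponent (hN : N.Admissible) (q : Fin T) (hy : 0 < y)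
    (hx : 0 < x) : ContinuousOn (fun r => N.stationExponent q y r x) (Ici 0) := by
  have hα := hN.two_lt_alpha
  have h1 : ContinuousOn (fun r => N.stationMGF q y r x) (Ici 0) := by
    unfold stationMGF
    have hc : Continuous fun r : ℝ => y * N.snr q * (r / x) ^ (N.alpha / 2) :=
      continuous_const.mul ((Real.continuous_rpow_const (by linarith)).comp (by fun_prop))
    have := (hN.interfLaw_fading q).continuousOn_fadingMGF.comp hc.continuousOn
      (s := Ici 0) (fun r hr => hN.stationArg_nonneg q hy hr hx)
    exact continuousOn_const.sub ((continuousOn_const.sub this).div_const _)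
  exact ENNReal.continuous_ofReal.comp_continuousOn
    ((h1.log fun r hr => (hN.stationMGF_pos q hy hr hx).ne').neg)

lemma Admissible.monotoneOn_stationExponent (hN : N.Admissible) (q : Fin T) (hy : 0 < y)
    (hx : 0 < x) : MonotoneOn (fun r => N.stationExponent q y r x) (Ici 0) := by
  intro r hr r' hr' hrr
  have hα := hN.two_lt_alpha
  have hs := hN.snr_pos q
  have h1 := hN.one_le_bands_real q
  have hr0 : (0 : ℝ) ≤ r := hr
  refine ENNReal.ofReal_le_ofReal (neg_le_neg (Real.log_le_log
    (hN.stationMGF_pos q hy hr' hx) ?_))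
  have h := (hN.interfLaw_fading q).antitoneOn_fadingMGF (hN.stationArg_nonneg q hy hr hx)
    (hN.stationArg_nonneg q hy hr' hx) (by gcongr)
  unfold stationMGF
  gcongr

/-- No measurability of `f` is assumed, because scaling is a measurable embedding. -/
lemma lintegral_Ioi_scale {R : ℝ} (hR : 0 < R) (f : ℝ → ℝ≥0∞) :
    ∫⁻ x in Ioi R, f x = ENNReal.ofReal R * ∫⁻ u in Ioi 1, f (R * u) := by
  have he : MeasurableEmbedding (fun u : ℝ => R * u) :=
    (Homeomorph.mulLeft₀ R hR.ne').measurableEmbedding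
  have hpre : (fun u : ℝ => R * u) ⁻¹' Ioi R = Ioi 1 := by
    ext u
    simp only [mem_preimage, mem_Ioi]
    exact lt_mul_iff_one_lt_right hR
  conv_lhs => rw [← Real.smul_map_volume_mul_left hR.ne']
  rw [Measure.restrict_smul, lintegral_smul_measure, abs_of_pos hR, he.restrict_map, hpre,
    he.lintegral_map, smul_eq_mul]

/-- Substitute `x = ρ r u` with `ρ` the exclusion factor. Since `ρ^{α/2}` is the power-bias ratio,
the argument of the transform becomes `interfArg * u^{-α/2}`, free of `r`, and the fading identity
over `u > 1` applies. -/
lemma Admissible.lintegral_stationExponent (hN : N.Admissible) (t q : Fin T) (hy : 0 < y)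
    (hr : 0 < r) :
    ∫⁻ x in Ioi (N.exclusion t q * r), (1 - expNeg (N.stationExponent q y r x))
      = ENNReal.ofReal (r * (N.pairZ t q y / N.bands q - N.exclusion t q)) := by
  have hR : 0 < N.exclusion t q * r := mul_pos (hN.exclusion_pos t q) hr
  have hF := hN.one_le_bands_real q
  have hρ := hN.exclusion_pos t q
  rw [lintegral_Ioi_scale hR]
  have h1 : ∀ u ∈ Ioi (1 : ℝ), 1 - expNeg (N.stationExponent q y r (N.exclusion t q * r * u))
      = ENNReal.ofReal (1 / N.bands q) * ENNReal.ofReal (1 - fadingMGF (N.interfLaw q)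
          (N.interfArg t q y * u ^ (-(N.alpha / 2)))) := by
    intro u hu
    have hu0 : 0 < u := one_pos.trans hu
    have e : r / (N.exclusion t q * r * u) = (N.exclusion t q * u)⁻¹ := by field_simp
    rw [hN.one_sub_expNeg_stationExponent q hy hr.le (by positivity), e,
      ← ENNReal.ofReal_mul (by positivity), Real.inv_rpow (by positivity),
      Real.mul_rpow hρ.le hu0.le, hN.exclusion_rpow, Real.rpow_neg hu0.le, interfArg]
    congr 1
    rw [show y * N.snr q * (N.ratio t q * u ^ (N.alpha / 2))⁻¹
      = (N.ratio t q)⁻¹ * N.snr q * y * (u ^ (N.alpha / 2))⁻¹ by rw [mul_inv]; ring]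
    ring
  rw [setLIntegral_congr_fun measurableSet_Ioi h1, lintegral_const_mul' _ _ ENNReal.ofReal_ne_top,
    (hN.interfLaw_fading q).lintegral_Ioi_one_sub hN.two_lt_alpha (hN.interfArg_pos t q hy),
    ← ENNReal.ofReal_mul (by positivity), ← ENNReal.ofReal_mul (by positivity), pairZ_eq]
  congr 1
  rw [← exclusion]
  field_simp
  ring

/-- The exponent of the avoidance probability and of the interference of a tier. -/
lemma Admissible.lintegral_exclusion (hN : N.Admissible) (t q : Fin T) (hy : 0 < y)
    (hr : 0 < r) :
    ∫⁻ x in Ioi 0, (1 - expNeg ((if x < N.exclusion t q * r then ∞ else 0)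
        + N.stationExponent q y r x))
      = ENNReal.ofReal (r * (N.pairZ t q y / N.bands q)) := by
  have hR : 0 < N.exclusion t q * r := mul_pos (hN.exclusion_pos t q) hr
  have hF := hN.one_le_bands_real q
  -- Inside the exclusion radius the exponent is infinite and the integrand is `1`, so this part
  -- contributes `ρ r`, exactly what is subtracted in `lintegral_stationExponent`. The boundary
  -- point is not excluded, but is a null set.
  rw [← Ioc_union_Ioi_eq_Ioi hR.le, lintegral_union measurableSet_Ioi
    (Ioc_disjoint_Ioi le_rfl), setLIntegral_congr (Ioo_ae_eq_Ioc).symm]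
  have h1 : ∀ x ∈ Ioo 0 (N.exclusion t q * r), 1 - expNeg ((if x < N.exclusion t q * r then ∞ else 0)
        + N.stationExponent q y r x) = 1 := by
    intro x hx
    simp [hx.2]
  have h2 : ∀ x ∈ Ioi (N.exclusion t q * r),
      1 - expNeg ((if x < N.exclusion t q * r then ∞ else 0) + N.stationExponent q y r x)
        = 1 - expNeg (N.stationExponent q y r x) := by
    intro x hx
    rw [if_neg (not_lt.2 (le_of_lt hx)), zero_add]
  have hle : N.exclusion t q ≤ N.pairZ t q y / N.bands q := by
    rw [le_div_iff₀ (by linarith), pairZ_eq, ← exclusion]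
    have h := (hN.interfLaw_fading q).one_sub_le_fadingT hN.two_lt_alpha
      (hN.interfArg_pos t q hy)
    exact mul_le_mul_of_nonneg_left (by linarith) (hN.exclusion_pos t q).le
  rw [setLIntegral_congr_fun measurableSet_Ioo h1, setLIntegral_congr_fun measurableSet_Ioi h2,
    hN.lintegral_stationExponent t q hy hr, lintegral_const, Measure.restrict_apply_univ, one_mul,
    Real.volume_Ioo, ← ENNReal.ofReal_add (by linarith)
      (mul_nonneg hr.le (sub_nonneg.2 hle))]
  congr 1
  ring

end Network

namespace Network

variable {T : ℕ}

open Classical in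
/-- The exponent contributed by a base station of tier `q` at squared distance `x` with gain and
band `z`, when the serving base station, in tier `t`, is at squared distance `r`: it is infinite
if the base station lies in the exclusion disc. -/
noncomputable def linkExponent (N : Network T) (ch : (q : Fin T) → Fin (N.bands q)) (t q : Fin T)
    (y r x : ℝ) (z : ℝ × Fin (N.bands q)) : ℝ≥0∞ :=
  (if x < N.exclusion t q * r then ∞ else 0) +
    if ¬ (q = t ∧ x = r) ∧ z.2 = ch q then
      ENNReal.ofReal (y * N.snr q * (r / x) ^ (N.alpha / 2) * z.1) else 0

open Classical in
/-- The exponent of the mean of `exp (-linkExponent)` over gain and band. -/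
noncomputable def meanExponent (N : Network T) (t q : Fin T) (y r x : ℝ) : ℝ≥0∞ :=
  (if x < N.exclusion t q * r then ∞ else 0) +
    if q = t ∧ x = r then 0 else N.stationExponent q y r x

lemma measurable_linkExponent (N : Network T) (ch : (q : Fin T) → Fin (N.bands q)) (t q : Fin T)
    (y : ℝ) : Measurable fun u : ℝ × ℝ × (ℝ × Fin (N.bands q)) =>
      N.linkExponent ch t q y u.1 u.2.1 u.2.2 := by
  unfold linkExponent
  refine Measurable.add (Measurable.ite (measurableSet_lt (by fun_prop) (by fun_prop))
    measurable_const measurable_const) (Measurable.ite ?_ (by fun_prop) measurable_const)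
  refine MeasurableSet.inter ?_ ?_
  · refine MeasurableSet.compl (MeasurableSet.inter (MeasurableSet.const _) ?_)
    exact measurableSet_eq_fun (by fun_prop) (by fun_prop)
  · exact measurable_snd.snd.snd (measurableSet_singleton (ch q))

end Network

/-! ### Pathwise identities for regular configurations -/

namespace Deployment

variable {T : ℕ} {N : Network T} {Ω : Type*}

/-- Squared distance of the `b`-th base station of tier `q` from the origin. -/
noncomputable def sqDist (D : Deployment N Ω) (q : Fin T) (b : ℕ) (ω : Ω) : ℝ := ‖D.pos q b ω‖ ^ 2

/-- Squared distance of the nearest base station of tier `q`. -/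
noncomputable def sqNearest (D : Deployment N Ω) (q : Fin T) (ω : Ω) : ℝ := ⨅ b, D.sqDist q b ω

/-- No base station is at the origin and every tier has a nearest base station. -/
def Regular (D : Deployment N Ω) (ω : Ω) : Prop :=
  ∀ q, (∀ b, 0 < D.sqDist q b ω) ∧ ∃ b, D.sqDist q b ω = D.sqNearest q ω

section Regular

variable {D : Deployment N Ω} {ω : Ω} {t q : Fin T} {y : ℝ}

lemma Regular.sqNearest_pos (h : D.Regular ω) (q : Fin T) : 0 < D.sqNearest q ω := by
  obtain ⟨h1, b, hb⟩ := h q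
  rw [← hb]
  exact h1 b

lemma Regular.sqNearest_le (h : D.Regular ω) (q : Fin T) (b : ℕ) :
    D.sqNearest q ω ≤ D.sqDist q b ω :=
  ciInf_le ⟨0, forall_mem_range.2 fun b => ((h q).1 b).le⟩ b

/-- The infimum is attained, so one station minimises both the distance and its square. -/
lemma Regular.nearest_sq (h : D.Regular ω) (q : Fin T) :
    0 ≤ D.nearest q ω ∧ D.nearest q ω ^ 2 = D.sqNearest q ω := by
  obtain ⟨b, hb⟩ := (h q).2
  have : D.nearest q ω = D.dist q b ω := by
    refine le_antisymm (ciInf_le ⟨0, forall_mem_range.2 fun b => norm_nonneg _⟩ b)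
      (le_ciInf fun c => ?_)
    have h1 := h.sqNearest_le q c
    rw [← hb] at h1
    exact (sq_le_sq₀ (norm_nonneg _) (norm_nonneg _)).1 h1
  rw [this, ← hb]
  exact ⟨norm_nonneg _, rfl⟩

lemma Regular.nearest_rpow (h : D.Regular ω) (q : Fin T) (a : ℝ) :
    D.nearest q ω ^ a = D.sqNearest q ω ^ (a / 2) := by
  obtain ⟨h0, h1⟩ := h.nearest_sq q
  rw [← h1, ← Real.rpow_natCast, ← Real.rpow_mul h0]
  congr 1
  push_cast
  ring

lemma dist_rpow (D : Deployment N Ω) (q : Fin T) (b : ℕ) (ω : Ω) (a : ℝ) :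
    D.dist q b ω ^ a = D.sqDist q b ω ^ (a / 2) := by
  rw [sqDist, ← Real.rpow_natCast, ← Real.rpow_mul (norm_nonneg _), dist]
  congr 1
  push_cast
  ring

lemma Regular.dist_eq_nearest_iff (h : D.Regular ω) (q : Fin T) (b : ℕ) :
    D.dist q b ω = D.nearest q ω ↔ D.sqDist q b ω = D.sqNearest q ω := by
  obtain ⟨h0, h1⟩ := h.nearest_sq q
  rw [← h1, sqDist, sq_eq_sq₀ (norm_nonneg _) h0, dist]

/-- Raising to the power `α/2` turns the comparison of biased powers into a comparison of squared
distances: association means that every tier avoids its exclusion disc. -/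
lemma Regular.mem_assoc_iff (h : D.Regular ω) (hN : N.Admissible) (t : Fin T) :
    ω ∈ D.assoc t ↔ ∀ q b, N.exclusion t q * D.sqNearest t ω ≤ D.sqDist q b ω := by
  have hα := hN.two_lt_alpha
  have hm := h.sqNearest_pos t
  have h1 : ω ∈ D.assoc t ↔ ∀ q, N.exclusion t q * D.sqNearest t ω ≤ D.sqNearest q ω := by
    refine forall_congr' fun q => ?_
    have hq := h.sqNearest_pos q
    have hρ := hN.exclusion_pos t q
    have hPq := hN.power_pos q
    have hPt := hN.power_pos t
    have hBq := hN.bias_pos q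
    have hBt := hN.bias_pos t
    rw [h.nearest_rpow, h.nearest_rpow, neg_div, Real.rpow_neg hm.le, Real.rpow_neg hq.le,
      ← Real.rpow_le_rpow_iff (z := N.alpha / 2) (by positivity) hq.le (by linarith),
      Real.mul_rpow hρ.le hm.le, hN.exclusion_rpow, Network.ratio]
    have h3 : 0 < D.sqNearest t ω ^ (N.alpha / 2) := by positivity
    have h4 : 0 < D.sqNearest q ω ^ (N.alpha / 2) := by positivity
    set A := D.sqNearest t ω ^ (N.alpha / 2)
    set B := D.sqNearest q ω ^ (N.alpha / 2)
    rw [show N.power q * B⁻¹ * N.bias q = N.power q * N.bias q / B by ring,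
      show N.power t * A⁻¹ * N.bias t = N.power t * N.bias t / A by ring,
      div_le_div_iff₀ h4 h3, show N.power q / N.power t * (N.bias q / N.bias t) * A
        = N.power q * N.bias q * A / (N.power t * N.bias t) by ring,
      div_le_iff₀ (by positivity), mul_comm B]
  rw [h1]
  refine forall_congr' fun q => ⟨fun h2 b => h2.trans (h.sqNearest_le q b), fun h2 => ?_⟩
  obtain ⟨b, hb⟩ := (h q).2
  rw [← hb]
  exact h2 b

/-- On the association event no exclusion term is active and the link exponents sum to the scaled
interference. Off it, some station lies in its exclusion disc and the exponent is infinite, so both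
sides vanish. -/
lemma Regular.indicator_mul_expNeg (h : D.Regular ω) (hN : N.Admissible)
    (ch : (q : Fin T) → Fin (N.bands q)) (t : Fin T) (hy : 0 < y) :
    (D.assoc t).indicator (fun ω => expNeg (ENNReal.ofReal (y * D.sqNearest t ω ^ (N.alpha / 2))
        + ENNReal.ofReal (y * D.sqNearest t ω ^ (N.alpha / 2) / N.noise)
          * D.interference ch t ω)) ω
      = expNeg (ENNReal.ofReal (y * D.sqNearest t ω ^ (N.alpha / 2)) +
          ∑' k : Fin T × ℕ, N.linkExponent ch t k.1 y (D.sqNearest t ω) (D.sqDist k.1 k.2 ω)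
            (D.gain k.1 k.2 ω, D.band k.1 k.2 ω)) := by
  by_cases hω : ω ∈ D.assoc t
  · rw [indicator_of_mem hω]
    rw [h.mem_assoc_iff hN] at hω
    congr 2
    rw [interference, Finset.mul_sum, ENNReal.tsum_prod', tsum_fintype]
    refine Finset.sum_congr rfl fun q _ => ?_
    rw [← ENNReal.tsum_mul_left]
    refine tsum_congr fun b => ?_
    simp only [Network.linkExponent]
    rw [if_neg (not_lt.2 (hω q b)), zero_add]
    have hiff : D.Interferes ch t q b ω ↔
        ¬ (q = t ∧ D.sqDist q b ω = D.sqNearest t ω) ∧ D.band q b ω = ch q := by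
      unfold Interferes
      refine and_congr_left fun _ => not_congr (and_congr_right fun hqt => ?_)
      subst hqt
      exact h.dist_eq_nearest_iff q b
    have hm := h.sqNearest_pos t
    have hx := (h q).1 b
    have hσ := hN.noise_pos
    simp only [hiff]
    split_ifs
    · rw [← ENNReal.ofReal_mul (by positivity)]
      congr 1
      rw [D.dist_rpow, neg_div, Real.rpow_neg hx.le, Real.div_rpow hm.le hx.le, Network.snr]
      ring
    · rw [mul_zero]
  · rw [indicator_of_notMem hω]
    rw [h.mem_assoc_iff hN] at hω
    push Not at hω
    obtain ⟨q, b, hb⟩ := hω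
    have : ∑' k : Fin T × ℕ, N.linkExponent ch t k.1 y (D.sqNearest t ω) (D.sqDist k.1 k.2 ω)
            (D.gain k.1 k.2 ω, D.band k.1 k.2 ω) = ∞ := by
      refine ENNReal.tsum_eq_top_of_eq_top ⟨(q, b), ?_⟩
      simp [Network.linkExponent, hb]
    rw [this]
    simp

/-- The Shannon rate as an integral over the Laplace variable. -/
lemma Regular.ofReal_log (h : D.Regular ω) (hN : N.Admissible)
    (ch : (q : Fin T) → Fin (N.bands q)) (t : Fin T) (hg : 0 ≤ D.gain0 t ω) :
    ENNReal.ofReal (Real.log (1 + (D.sinr ch t ω).toReal))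
      = ∫⁻ y in Ioi 0, ENNReal.ofReal ((1 - Real.exp (-(N.snr t * y * D.gain0 t ω))) / y) *
        expNeg (ENNReal.ofReal (y * D.sqNearest t ω ^ (N.alpha / 2))
        + ENNReal.ofReal (y * D.sqNearest t ω ^ (N.alpha / 2) / N.noise)
          * D.interference ch t ω) := by
  have hm := h.sqNearest_pos t
  have hσ := hN.noise_pos
  have hP := hN.power_pos t
  have hs := hN.snr_pos t
  rw [sinr, h.nearest_rpow, neg_div, Real.rpow_neg hm.le]
  set A := D.sqNearest t ω ^ (N.alpha / 2) with hA
  have hA0 : 0 < A := by positivity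
  -- Infinite interference is not excluded beforehand: then the SINR is `0` and the integrand
  -- vanishes as well.
  by_cases hI : D.interference ch t ω = ∞
  · rw [hI, add_top, ENNReal.div_top, ENNReal.toReal_zero, add_zero, Real.log_one,
      ENNReal.ofReal_zero]
    symm
    refine setLIntegral_eq_zero measurableSet_Ioi fun y hy => ?_
    have hy' : (0 : ℝ) < y := hy
    rw [ENNReal.mul_top (ENNReal.ofReal_pos.2 (by positivity)).ne', add_top, expNeg_top, mul_zero,
      Pi.zero_apply]
  · obtain ⟨J, hJ⟩ : ∃ J : ℝ≥0, (J : ℝ≥0∞) = D.interference ch t ω :=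
      WithTop.ne_top_iff_exists.1 hI
    rw [← hJ, ← ENNReal.ofReal_coe_nnreal]
    have hJ0 := J.coe_nonneg
    set j : ℝ := (J : ℝ)
    rw [← ENNReal.ofReal_add hσ.le hJ0, ← ENNReal.ofReal_div_of_pos (by positivity),
      ENNReal.toReal_ofReal (by positivity)]
    have e : N.power t * D.gain0 t ω * A⁻¹ / (N.noise + j)
        = (N.snr t * D.gain0 t ω) / (A * (1 + j / N.noise)) := by
      rw [Network.snr]
      field_simp
    rw [e, ← lintegral_log_one_add_div (by positivity) (by positivity)]
    refine setLIntegral_congr_fun measurableSet_Ioi fun y hy => ?_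
    have hy' : (0 : ℝ) < y := hy
    rw [← ENNReal.ofReal_mul (by positivity), ← ENNReal.ofReal_add (by positivity) (by positivity),
      expNeg_ofReal (by positivity), ← ENNReal.ofReal_mul]
    · congr 1
      rw [show -(y * A + y * A / N.noise * j) = -(y * (A * (1 + j / N.noise))) by ring,
        show y * (N.snr t * D.gain0 t ω) = N.snr t * y * D.gain0 t ω by ring]
      ring
    · refine div_nonneg (sub_nonneg.2 ?_) hy'.le
      rw [Real.exp_le_one_iff, neg_nonpos]
      positivity

end Regular

/-! ### Measurability of the random quantities -/

section Measurability

variable [MeasurableSpace Ω] {D : Deployment N Ω}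

lemma measurable_sqDist (hpos : ∀ q b, Measurable (D.pos q b)) (q : Fin T) (b : ℕ) :
    Measurable (D.sqDist q b) := (hpos q b).norm.pow_const 2

lemma measurable_sqNearest (hpos : ∀ q b, Measurable (D.pos q b)) (q : Fin T) :
    Measurable (D.sqNearest q) := Measurable.iInf fun b => measurable_sqDist hpos q b

lemma measurable_nearest (hpos : ∀ q b, Measurable (D.pos q b)) (q : Fin T) :
    Measurable (D.nearest q) := Measurable.iInf fun b => (hpos q b).norm

lemma measurableSet_assoc (hpos : ∀ q b, Measurable (D.pos q b)) (t : Fin T) :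
    MeasurableSet (D.assoc t) := by
  have h := fun q => measurable_nearest (D := D) hpos q
  rw [assoc, ofPred_forall]
  exact MeasurableSet.iInter fun q => measurableSet_le (by fun_prop) (by fun_prop)

lemma measurable_interference (hpos : ∀ q b, Measurable (D.pos q b))
    (hgain : ∀ q b, Measurable (D.gain q b)) (hband : ∀ q b, Measurable (D.band q b))
    (ch : (q : Fin T) → Fin (N.bands q)) (t : Fin T) : Measurable (D.interference ch t) := by
  have hn := fun q => measurable_nearest (D := D) hpos q
  have hd : ∀ q b, Measurable (D.dist q b) := fun q b => (hpos q b).norm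
  unfold interference
  refine Finset.measurable_sum _ fun q _ => Measurable.tsum fun b =>
    Measurable.ite ?_ (by fun_prop) measurable_const
  refine MeasurableSet.inter ?_ (hband q b (measurableSet_singleton (ch q)))
  exact MeasurableSet.compl (MeasurableSet.inter (MeasurableSet.const _)
    (measurableSet_eq_fun (hd q b) (hn t)))

end Measurability

end Deployment

/-! ### Averaging over gains and bands, then over positions -/

namespace Deployment

variable {T : ℕ} {N : Network T} {Ω : Type*} {D : Deployment N Ω}

lemma measurable_of_apply_apply {κ : Type*} {β : κ → Type*} {_ : MeasurableSpace Ω}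
    [∀ k, MeasurableSpace (β k)] {f : Ω → (k : κ) → ℕ → β k}
    (h : ∀ k b, Measurable fun ω => f ω k b) : Measurable f :=
  measurable_pi_lambda _ fun k => measurable_pi_lambda _ fun b => h k b

lemma measurable_tsum_of_apply {_ : MeasurableSpace Ω} {f : ℕ → Ω → ℝ≥0∞}
    (h : ∀ b, Measurable (f b)) : Measurable fun ω => ∑' b, f b ω := Measurable.tsum h

lemma measurable_pos_of_mem {S : Set (Source T)} {q : Fin T} (h : Source.pos q ∈ S) (b : ℕ) :
    Measurable[⨆ i ∈ S, D.sigma i] (D.pos q b) :=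
  ((comap_measurable (D.pos q b)).mono
    (le_iSup (fun b => MeasurableSpace.comap (D.pos q b) inferInstance) b) le_rfl).mono
    (le_iSup₂ (f := fun i (_ : i ∈ S) => D.sigma i) _ h) le_rfl

lemma measurable_sqDist_of_mem {S : Set (Source T)} {q : Fin T} (h : Source.pos q ∈ S) (b : ℕ) :
    Measurable[⨆ i ∈ S, D.sigma i] (D.sqDist q b) :=
  measurable_normSq_plane.comp (measurable_pos_of_mem h b)

lemma measurable_gain_of_mem {S : Set (Source T)} {q : Fin T} {b : ℕ}
    (h : Source.gain q b ∈ S) : Measurable[⨆ i ∈ S, D.sigma i] (D.gain q b) :=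
  (comap_measurable (D.gain q b)).mono
    (le_iSup₂ (f := fun i (_ : i ∈ S) => D.sigma i) _ h) le_rfl

lemma measurable_band_of_mem {S : Set (Source T)} {q : Fin T} {b : ℕ}
    (h : Source.band q b ∈ S) : Measurable[⨆ i ∈ S, D.sigma i] (D.band q b) :=
  (comap_measurable (D.band q b)).mono
    (le_iSup₂ (f := fun i (_ : i ∈ S) => D.sigma i) _ h) le_rfl

lemma measurable_gain0_of_mem {S : Set (Source T)} {q : Fin T}
    (h : Source.gain0 q ∈ S) : Measurable[⨆ i ∈ S, D.sigma i] (D.gain0 q) :=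
  (comap_measurable (D.gain0 q)).mono
    (le_iSup₂ (f := fun i (_ : i ∈ S) => D.sigma i) _ h) le_rfl

variable [mΩ : MeasurableSpace Ω] {μ : Measure Ω} {y : ℝ}

lemma IsModel.poisson_sqDist (hD : D.IsModel μ) (hN : N.Admissible) (q : Fin T) :
    IsPoissonProcess (D.sqDist q)
      (ENNReal.ofReal (Real.pi * N.density q) • volume.restrict (Ioi 0)) μ :=
  (hD.poisson q).normSq (hN.density_pos q).le

lemma IsModel.measurable_pos (hD : D.IsModel μ) (q : Fin T) (b : ℕ) : Measurable (D.pos q b) :=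
  (hD.poisson q).measurable b

lemma IsModel.sigma_le (hD : D.IsModel μ) (i : Source T) : D.sigma i ≤ mΩ := by
  cases i with
  | pos q => exact iSup_le fun b => (hD.measurable_pos q b).comap_le
  | gain q b => exact (hD.measurable_gain q b).comap_le
  | band q b => exact (hD.measurable_band q b).comap_le
  | gain0 q => exact (hD.measurable_gain0 q).comap_le

lemma IsModel.ae_gain_nonneg (hD : D.IsModel μ) (hN : N.Admissible) (q : Fin T) (b : ℕ) :
    ∀ᵐ ω ∂μ, 0 ≤ D.gain q b ω := by
  have h := (hN.interfLaw_fading q).nonneg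
  rw [← hD.law_gain q b] at h
  exact ae_of_ae_map (hD.measurable_gain q b).aemeasurable h

lemma IsModel.ae_gain0_nonneg (hD : D.IsModel μ) (hN : N.Admissible) (q : Fin T) :
    ∀ᵐ ω ∂μ, 0 ≤ D.gain0 q ω := by
  have h := (hN.servLaw_fading q).nonneg
  rw [← hD.law_gain0 q] at h
  exact ae_of_ae_map (hD.measurable_gain0 q).aemeasurable h

variable [IsProbabilityMeasure μ]

lemma IsModel.ae_regular (hD : D.IsModel μ) (hN : N.Admissible) : ∀ᵐ ω ∂μ, D.Regular ω := by
  have h : ∀ q, ∀ᵐ ω ∂μ, (∀ b, 0 < D.sqDist q b ω) ∧ ∃ b, D.sqDist q b ω = D.sqNearest q ω := by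
    intro q
    have hP := hD.poisson_sqDist hN q
    filter_upwards [hP.ae_pos, hP.ae_exists_eq_iInf] with ω h1 h2
    exact ⟨h1, h2⟩
  exact ae_all_iff.2 h

open Classical in
/-- Averaging over the gain and the band of one base station. -/
lemma IsModel.lintegral_gain_band (hD : D.IsModel μ) (hN : N.Admissible) (q : Fin T) (b : ℕ)
    (j : Fin (N.bands q)) {s : ℝ} (hs : 0 ≤ s) :
    ∫⁻ ω, expNeg (if D.band q b ω = j then ENNReal.ofReal (s * D.gain q b ω) else 0) ∂μ
      = ENNReal.ofReal (1 - (1 - fadingMGF (N.interfLaw q) s) / N.bands q) := by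
  have hF := hN.one_le_bands_real q
  have hA : MeasurableSet (D.band q b ⁻¹' {j}) := hD.measurable_band q b (measurableSet_singleton j)
  set f : Ω → ℝ≥0∞ := (D.band q b ⁻¹' {j}).indicator 1 with hf
  set g : Ω → ℝ≥0∞ := fun ω => ENNReal.ofReal (Real.exp (-(s * D.gain q b ω))) with hg
  have hgm : Measurable g := by
    have := hD.measurable_gain q b
    fun_prop
  have hfm : Measurable f := measurable_one.indicator hA
  -- With probability `1/F` the station picks the relevant band and contributes the transform of its
  -- gain; otherwise it contributes `1`.
  have e : ∫⁻ ω, expNeg (if D.band q b ω = j then ENNReal.ofReal (s * D.gain q b ω) else 0) ∂μ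
      = ∫⁻ ω, (f ω * g ω + (D.band q b ⁻¹' {j})ᶜ.indicator 1 ω) ∂μ := by
    refine lintegral_congr_ae ?_
    filter_upwards [hD.ae_gain_nonneg hN q b] with ω hω
    by_cases h : D.band q b ω = j
    · simp [hf, hg, h, expNeg_ofReal (mul_nonneg hs hω)]
    · simp [hf, h]
  have hind : IndepFun (D.band q b) (D.gain q b) μ :=
    hD.indep.indepFun_of_disjoint hD.sigma_le
      (S := {Source.band q b}) (S' := {Source.gain q b}) (by simp)
      (measurable_band_of_mem (mem_singleton _)) (measurable_gain_of_mem (mem_singleton _))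
  have hfg : IndepFun f g μ := by
    have h1 : f = ({j} : Set (Fin (N.bands q))).indicator (1 : Fin (N.bands q) → ℝ≥0∞)
        ∘ D.band q b := by
      rfl
    have h2 : g = (fun x : ℝ => ENNReal.ofReal (Real.exp (-(s * x)))) ∘ D.gain q b := rfl
    rw [h1, h2]
    exact hind.comp (measurable_of_countable _) (by fun_prop)
  have hgint : ∫⁻ ω, g ω ∂μ = ENNReal.ofReal (fadingMGF (N.interfLaw q) s) := by
    rw [(hN.interfLaw_fading q).ofReal_fadingMGF hs, ← hD.law_gain q b,
      lintegral_map (by fun_prop) (hD.measurable_gain q b)]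
  have hinv : (N.bands q : ℝ≥0∞)⁻¹ = ENNReal.ofReal (1 / N.bands q) := by
    rw [one_div, ENNReal.ofReal_inv_of_pos (by linarith), ENNReal.ofReal_natCast]
  have hM := (hN.interfLaw_fading q).fadingMGF_pos hs
  have hF1 : 1 / (N.bands q : ℝ) ≤ 1 := by
    rw [div_le_one (by linarith)]; exact hF
  rw [e, lintegral_add_left (show Measurable fun ω => f ω * g ω from hfm.mul hgm),
    lintegral_mul_eq_lintegral_mul_lintegral_of_indepFun'' hfm.aemeasurable hgm.aemeasurable hfg,
    hgint, hf, lintegral_indicator_one hA, lintegral_indicator_one hA.compl, prob_compl_eq_one_sub hA,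
    hD.law_band, hinv, ← ENNReal.ofReal_mul (by positivity), ← ENNReal.ofReal_one,
    ← ENNReal.ofReal_sub _ (by positivity), ← ENNReal.ofReal_add (by positivity) (by linarith)]
  congr 1
  ring

/-- The exclusion term is deterministic once the position is fixed, so it factors out; the serving
station itself contributes nothing. -/
lemma IsModel.lintegral_linkExponent (hD : D.IsModel μ) (hN : N.Admissible)
    (ch : (q : Fin T) → Fin (N.bands q)) (t q : Fin T) (b : ℕ) (hy : 0 < y) {r x : ℝ}
    (hr : 0 ≤ r) (hx : 0 < x) :
    ∫⁻ ω, expNeg (N.linkExponent ch t q y r x (D.gain q b ω, D.band q b ω)) ∂μ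
      = expNeg (N.meanExponent t q y r x) := by
  classical
  unfold Network.linkExponent Network.meanExponent
  simp_rw [expNeg_add]
  rw [lintegral_const_mul' _ _ (expNeg_ne_top _)]
  congr 1
  by_cases h : q = t ∧ x = r
  · simp [h]
  · simp only [h, not_false_eq_true, true_and, if_false]
    rw [hN.expNeg_stationExponent q hy hr hx, Network.stationMGF,
      ← hD.lintegral_gain_band hN q b (ch q) (hN.stationArg_nonneg q hy hr hx)]

/-- Averaging over all gains and bands, the positions being fixed. -/
lemma IsModel.lintegral_marks (hD : D.IsModel μ) (hN : N.Admissible)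
    (ch : (q : Fin T) → Fin (N.bands q)) (t : Fin T) (hy : 0 < y) {r : ℝ}
    (hr : 0 ≤ r) {x : Fin T → ℕ → ℝ} (hx : ∀ q b, 0 < x q b) :
    ∫⁻ ω, expNeg (∑' k : Fin T × ℕ, N.linkExponent ch t k.1 y r (x k.1 k.2)
        (D.gain k.1 k.2 ω, D.band k.1 k.2 ω)) ∂μ
      = expNeg (∑' k : Fin T × ℕ, N.meanExponent t k.1 y r (x k.1 k.2)) := by
  refine hD.indep.lintegral_expNeg_tsum hD.sigma_le
    (S := fun k : Fin T × ℕ => {Source.gain k.1 k.2, Source.band k.1 k.2}) ?_ ?_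
    fun k => hD.lintegral_linkExponent hN ch t k.1 k.2 hy hr (hx _ _)
  · rintro ⟨q, b⟩ ⟨q', b'⟩ hne
    simp only [Function.onFun, Set.disjoint_left]
    rintro _ (rfl | rfl) (h | h)
    · cases h; exact hne rfl
    · cases h
    · cases h
    · cases h; exact hne rfl
  · rintro ⟨q, b⟩
    refine (N.measurable_linkExponent ch t q y).comp (measurable_const.prodMk
      (measurable_const.prodMk (Measurable.prodMk ?_ ?_)))
    · exact measurable_gain_of_mem (by simp)
    · exact measurable_band_of_mem (by simp)

/-- The squared distances are independent of the gains and the bands. -/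
lemma IsModel.lintegral_expNeg_link (hD : D.IsModel μ) (hN : N.Admissible)
    (ch : (q : Fin T) → Fin (N.bands q)) (t : Fin T) (hy : 0 < y) :
    ∫⁻ ω, expNeg (ENNReal.ofReal (y * D.sqNearest t ω ^ (N.alpha / 2)) +
          ∑' k : Fin T × ℕ, N.linkExponent ch t k.1 y (D.sqNearest t ω) (D.sqDist k.1 k.2 ω)
            (D.gain k.1 k.2 ω, D.band k.1 k.2 ω)) ∂μ
      = ∫⁻ ω, expNeg (ENNReal.ofReal (y * D.sqNearest t ω ^ (N.alpha / 2)) +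
          ∑' k : Fin T × ℕ, N.meanExponent t k.1 y (D.sqNearest t ω) (D.sqDist k.1 k.2 ω)) ∂μ := by
  let X : Ω → Fin T → ℕ → ℝ := fun ω q b => D.sqDist q b ω
  let Y : Ω → (q : Fin T) → ℕ → ℝ × Fin (N.bands q) := fun ω q b => (D.gain q b ω, D.band q b ω)
  have hind : IndepFun X Y μ := by
    refine hD.indep.indepFun_of_disjoint hD.sigma_le (S := range Source.pos)
      (S' := (range Source.pos)ᶜ) disjoint_compl_right ?_ ?_
    · refine measurable_of_apply_apply fun q b => ?_
      exact measurable_sqDist_of_mem (mem_range_self q) b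
    · refine measurable_of_apply_apply fun q b => ?_
      exact (measurable_gain_of_mem (by simp)).prodMk (measurable_band_of_mem (by simp))
  have hX : Measurable X := measurable_pi_lambda _ fun q => measurable_pi_lambda _ fun b =>
    measurable_sqDist hD.measurable_pos q b
  have hY : Measurable Y := measurable_pi_lambda _ fun q => measurable_pi_lambda _ fun b =>
    (hD.measurable_gain q b).prodMk (hD.measurable_band q b)
  have hcoord : ∀ q b, Measurable fun z : (Fin T → ℕ → ℝ) ×
      ((q : Fin T) → ℕ → ℝ × Fin (N.bands q)) => z.1 q b := fun q b =>
    (measurable_pi_apply b).comp ((measurable_pi_apply q).comp measurable_fst)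
  have hmark : ∀ q b, Measurable fun z : (Fin T → ℕ → ℝ) ×
      ((q : Fin T) → ℕ → ℝ × Fin (N.bands q)) => z.2 q b := fun q b =>
    (measurable_pi_apply b).comp ((measurable_pi_apply q).comp measurable_snd)
  have hinf : Measurable fun z : (Fin T → ℕ → ℝ) ×
      ((q : Fin T) → ℕ → ℝ × Fin (N.bands q)) => ⨅ b, z.1 t b := Measurable.iInf fun b => hcoord t b
  let F : (Fin T → ℕ → ℝ) × ((q : Fin T) → ℕ → ℝ × Fin (N.bands q)) → ℝ≥0∞ := fun z =>
      expNeg (ENNReal.ofReal (y * (⨅ b, z.1 t b) ^ (N.alpha / 2)) +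
        ∑' k : Fin T × ℕ, N.linkExponent ch t k.1 y (⨅ b, z.1 t b) (z.1 k.1 k.2)
          (z.2 k.1 k.2))
  have hF : Measurable F := by
    refine measurable_expNeg.comp (Measurable.add
      ((hinf.pow_const _).const_mul y).ennreal_ofReal (Measurable.tsum fun k => ?_))
    exact (N.measurable_linkExponent ch t k.1 y).comp
      (hinf.prodMk ((hcoord k.1 k.2).prodMk (hmark k.1 k.2)))
  have hFX : ∀ ω ω', F (X ω, Y ω') = expNeg (ENNReal.ofReal
      (y * D.sqNearest t ω ^ (N.alpha / 2)) + ∑' k : Fin T × ℕ, N.linkExponent ch t k.1 y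
        (D.sqNearest t ω) (D.sqDist k.1 k.2 ω) (D.gain k.1 k.2 ω', D.band k.1 k.2 ω')) := by
    intro ω ω'
    simp only [F, X, Y, sqNearest]
  have h := hind.lintegral_eq hX hY hF
  simp_rw [hFX] at h
  rw [h]
  refine lintegral_congr_ae ?_
  filter_upwards [hD.ae_regular hN] with ω hω
  simp_rw [expNeg_add]
  rw [lintegral_const_mul' _ _ (expNeg_ne_top _),
    hD.lintegral_marks hN ch t hy (hω.sqNearest_pos t).le fun q b => (hω q).1 b]

/-- The avoidance probability and the interference of the tiers other than the serving one. -/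
lemma IsModel.lintegral_other_tiers (hD : D.IsModel μ) (hN : N.Admissible) (t : Fin T)
    (hy : 0 < y) {r : ℝ} (hr : 0 < r) :
    ∫⁻ ω, expNeg (∑ q : {q : Fin T // q ≠ t}, ∑' b,
        ((if D.sqDist q b ω < N.exclusion t q * r then ∞ else 0)
          + N.stationExponent q y r (D.sqDist q b ω))) ∂μ
      = expNeg (ENNReal.ofReal
          ((∑ q : {q : Fin T // q ≠ t}, Real.pi * N.reuseDensity q * N.pairZ t q y) * r)) := by
  have hm : ∀ q, Measurable fun x : ℝ => (if x < N.exclusion t q * r then ∞ else 0)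
        + N.stationExponent q y r x := fun q =>
    Measurable.add (Measurable.ite measurableSet_Iio measurable_const measurable_const)
      (hN.measurable_stationExponent q y measurable_const measurable_id)
  have hpos : ∀ q : {q : Fin T // q ≠ t},
      0 ≤ Real.pi * N.reuseDensity q * N.pairZ t q y * r := fun q => by
    have h1 := hN.reuseDensity_pos q
    have h2 := hN.pairZ_pos t q hy
    positivity
  have h := hD.indep.lintegral_expNeg_tsum hD.sigma_le
    (S := fun q : {q : Fin T // q ≠ t} => {Source.pos (q : Fin T)})
    (f := fun q ω => ∑' b, ((if D.sqDist q b ω < N.exclusion t q * r then ∞ else 0)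
          + N.stationExponent q y r (D.sqDist q b ω)))
    (c := fun q => ENNReal.ofReal (Real.pi * N.reuseDensity q * N.pairZ t q y * r)) ?_ ?_ ?_
  · simp_rw [tsum_fintype] at h
    rw [h, ← ENNReal.ofReal_sum_of_nonneg fun q _ => hpos q, Finset.sum_mul]
  · intro q q' hne
    simp only [Function.onFun, disjoint_singleton]
    intro h
    injection h with h
    exact hne (Subtype.ext h)
  · intro q
    refine measurable_tsum_of_apply fun b => (hm q).comp ?_
    exact measurable_sqDist_of_mem (mem_singleton _) b
  · intro q
    have hF := hN.one_le_bands_real q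
    have hl := hN.density_pos q
    rw [(hD.poisson_sqDist hN q).laplace (hm q), lintegral_smul_measure,
      hN.lintegral_exclusion t q hy hr, smul_eq_mul, ← ENNReal.ofReal_mul (by positivity)]
    congr 2
    rw [Network.reuseDensity]
    ring

/-- The law of the positions, seen through the mean exponents. -/
lemma IsModel.lintegral_expNeg_mean (hD : D.IsModel μ) (hN : N.Admissible) (t : Fin T)
    (hy : 0 < y) :
    ∫⁻ ω, expNeg (ENNReal.ofReal (y * D.sqNearest t ω ^ (N.alpha / 2)) +
          ∑' k : Fin T × ℕ, N.meanExponent t k.1 y (D.sqNearest t ω) (D.sqDist k.1 k.2 ω)) ∂μ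
      = ENNReal.ofReal (N.bands t) * ENNReal.ofReal (N.tierG N.reuseDensity t y) := by
  classical
  have hα := hN.two_lt_alpha
  have hFt := hN.one_le_bands_real t
  have hlt := hN.density_pos t
  set κ : ℝ := ∑ q : {q : Fin T // q ≠ t}, Real.pi * N.reuseDensity q * N.pairZ t q y with hκ
  have hκ0 : 0 ≤ κ := Finset.sum_nonneg fun q _ => by
    have h1 := hN.reuseDensity_pos q
    have h2 := hN.pairZ_pos t q hy
    positivity
  let X : Ω → ℕ → ℝ := fun ω b => D.sqDist t b ω
  let Y : Ω → {q : Fin T // q ≠ t} → ℕ → ℝ := fun ω q b => D.sqDist q b ω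
  have hind : IndepFun X Y μ := by
    refine hD.indep.indepFun_of_disjoint hD.sigma_le (S := {Source.pos t})
      (S' := {Source.pos t}ᶜ) disjoint_compl_right ?_ ?_
    -- A family indexed by one point, so that the lemma for doubly indexed families can be applied
    -- with the smaller σ-algebra.
    · refine (measurable_pi_apply ()).comp (measurable_of_apply_apply (κ := Unit)
        (f := fun ω _ b => D.sqDist t b ω) fun _ b => ?_)
      exact measurable_sqDist_of_mem (mem_singleton _) b
    · refine measurable_of_apply_apply fun q b => ?_
      refine measurable_sqDist_of_mem ?_ b
      intro h
      injection h with h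
      exact q.2 h
  have hX : Measurable X := measurable_pi_lambda _ fun b =>
    measurable_sqDist hD.measurable_pos t b
  have hY : Measurable Y := measurable_pi_lambda _ fun q => measurable_pi_lambda _ fun b =>
    measurable_sqDist hD.measurable_pos q b
  let F : (ℕ → ℝ) × ({q : Fin T // q ≠ t} → ℕ → ℝ) → ℝ≥0∞ := fun z =>
    expNeg (ENNReal.ofReal (y * (⨅ b, z.1 b) ^ (N.alpha / 2)) +
      (∑' b, if (⨅ c, z.1 c) < z.1 b then N.stationExponent t y (⨅ c, z.1 c) (z.1 b) else 0) +
      ∑ q : {q : Fin T // q ≠ t}, ∑' b,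
        ((if z.2 q b < N.exclusion t q * (⨅ c, z.1 c) then ∞ else 0)
          + N.stationExponent q y (⨅ c, z.1 c) (z.2 q b)))
  have hc1 : ∀ b, Measurable fun z : (ℕ → ℝ) × ({q : Fin T // q ≠ t} → ℕ → ℝ) => z.1 b :=
    fun b => (measurable_pi_apply b).comp measurable_fst
  have hc2 : ∀ q b, Measurable fun z : (ℕ → ℝ) × ({q : Fin T // q ≠ t} → ℕ → ℝ) => z.2 q b :=
    fun q b => (measurable_pi_apply b).comp ((measurable_pi_apply q).comp measurable_snd)
  have hinf : Measurable fun z : (ℕ → ℝ) × ({q : Fin T // q ≠ t} → ℕ → ℝ) => ⨅ b, z.1 b :=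
    Measurable.iInf hc1
  have hF : Measurable F := by
    refine measurable_expNeg.comp (Measurable.add (Measurable.add
      ((hinf.pow_const _).const_mul y).ennreal_ofReal
      (Measurable.tsum fun b => Measurable.ite (measurableSet_lt hinf (hc1 b))
        (hN.measurable_stationExponent t y hinf (hc1 b)) measurable_const))
      (Finset.measurable_sum _ fun q _ => Measurable.tsum fun b =>
        Measurable.add (Measurable.ite (measurableSet_lt (hc2 q b) (hinf.const_mul _))
          measurable_const measurable_const)
          (hN.measurable_stationExponent q y hinf (hc2 q b))))
  have hFX : ∀ ω ω', F (X ω, Y ω') = expNeg (ENNReal.ofReal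
      (y * D.sqNearest t ω ^ (N.alpha / 2)) + (∑' b, if D.sqNearest t ω < D.sqDist t b ω
        then N.stationExponent t y (D.sqNearest t ω) (D.sqDist t b ω) else 0) +
      ∑ q : {q : Fin T // q ≠ t}, ∑' b,
        ((if D.sqDist q b ω' < N.exclusion t q * D.sqNearest t ω then ∞ else 0)
          + N.stationExponent q y (D.sqNearest t ω) (D.sqDist q b ω'))) := by
    intro ω ω'
    rfl
  -- In tier `t` the exclusion factor is `1`, so its exclusion term is never active, and stations at
  -- the minimum contribute `0`: only points strictly beyond the nearest one remain.
  have e1 : ∫⁻ ω, expNeg (ENNReal.ofReal (y * D.sqNearest t ω ^ (N.alpha / 2)) +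
          ∑' k : Fin T × ℕ, N.meanExponent t k.1 y (D.sqNearest t ω) (D.sqDist k.1 k.2 ω)) ∂μ
      = ∫⁻ ω, F (X ω, Y ω) ∂μ := by
    refine lintegral_congr_ae ?_
    filter_upwards [hD.ae_regular hN] with ω hω
    rw [hFX]
    rw [ENNReal.tsum_prod', tsum_fintype, Fintype.sum_eq_add_sum_subtype_ne _ t, add_assoc]
    congr 3
    · refine tsum_congr fun b => ?_
      have hle := hω.sqNearest_le t b
      simp only [Network.meanExponent, hN.exclusion_self, one_mul, true_and]
      rw [if_neg (not_lt.2 hle), zero_add]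
      rcases hle.eq_or_lt with h | h
      · rw [if_pos h.symm, if_neg (by rw [h]; exact lt_irrefl _)]
      · rw [if_neg h.ne', if_pos h]
    · refine Finset.sum_congr rfl fun q _ => tsum_congr fun b => ?_
      simp [Network.meanExponent, q.2]
  -- With tier `t` frozen, the other tiers integrate to `exp(-κ r)`, where `r` is the squared
  -- distance of the serving station.
  have e2 : ∫⁻ ω, F (X ω, Y ω) ∂μ
      = ∫⁻ ω, expNeg (ENNReal.ofReal (y * D.sqNearest t ω ^ (N.alpha / 2) + κ * D.sqNearest t ω) +
          ∑' b, if D.sqNearest t ω < D.sqDist t b ω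
            then N.stationExponent t y (D.sqNearest t ω) (D.sqDist t b ω) else 0) ∂μ := by
    rw [hind.lintegral_eq hX hY hF]
    simp_rw [hFX]
    refine lintegral_congr_ae ?_
    filter_upwards [hD.ae_regular hN] with ω hω
    have hm := hω.sqNearest_pos t
    simp_rw [expNeg_add _ (∑ q : {q : Fin T // q ≠ t}, _)]
    rw [lintegral_const_mul' _ _ (expNeg_ne_top _), hD.lintegral_other_tiers hN t hy hm,
      ← expNeg_add, ENNReal.ofReal_add (by positivity) (by positivity), add_right_comm]
  have e3 := (hD.poisson_sqDist hN t).lintegral_nearest (by positivity)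
    (K := fun x => ENNReal.ofReal (y * x ^ (N.alpha / 2) + κ * x)) (H := N.stationExponent t y)
    (by fun_prop) (hN.measurable_stationExponent t y measurable_fst measurable_snd)
    (Continuous.continuousOn (ENNReal.continuous_ofReal.comp
      ((continuous_const.mul (Real.continuous_rpow_const (by linarith))).add (by fun_prop))))
    (fun x' hx' => hN.monotoneOn_stationExponent t hy hx')
    (fun x' hx' => hN.continuousOn_stationExponent t hy hx')
  rw [e1, e2]
  refine e3.trans ?_
  rw [hN.ofReal_tierG t hy, ← lintegral_const_mul _ (by fun_prop)]
  refine setLIntegral_congr_fun measurableSet_Ioi fun x hx => ?_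
  have hx0 : (0 : ℝ) < x := hx
  have hrest : ∫⁻ x' in Ioi 0, (1 - expNeg (if x < x' then N.stationExponent t y x x' else 0))
      = ENNReal.ofReal (x * (N.pairZ t t y / N.bands t - 1)) := by
    have h1 : ∀ x', 1 - expNeg (if x < x' then N.stationExponent t y x x' else 0)
        = (Ioi x).indicator (fun x' => 1 - expNeg (N.stationExponent t y x x')) x' := by
      intro x'
      by_cases h : x < x'
      · simp [h]
      · simp [h]
    simp_rw [h1]
    rw [setLIntegral_indicator measurableSet_Ioi, inter_eq_self_of_subset_left
      (Ioi_subset_Ioi hx0.le)]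
    have h2 := hN.lintegral_stationExponent t t hy hx0
    rwa [hN.exclusion_self, one_mul] at h2
  have hle : 1 ≤ N.pairZ t t y / N.bands t := by
    have h := (hN.interfLaw_fading t).one_sub_le_fadingT hN.two_lt_alpha
      (hN.interfArg_pos t t hy)
    rw [le_div_iff₀ (by linarith), N.pairZ_eq, hN.ratio_self, Real.one_rpow]
    linarith
  have hsub : 0 ≤ x * (N.pairZ t t y / N.bands t - 1) := mul_nonneg hx0.le (by linarith)
  rw [hrest, ← ENNReal.ofReal_mul (by positivity), ← ENNReal.ofReal_add (by positivity)
    (by positivity), expNeg_ofReal (by positivity), expNeg_ofReal (by positivity),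
    ← ENNReal.ofReal_mul (by positivity), ← ENNReal.ofReal_mul (by positivity),
    ← ENNReal.ofReal_mul (by have := hN.reuseDensity_pos t; positivity),
    ← ENNReal.ofReal_mul (by positivity), mul_assoc (Real.pi * N.density t), ← Real.exp_add,
    ← Real.exp_add]
  -- The nearest point has density `πλ_t`, whereas `G` carries the thinned `πλ'_t`; their quotient
  -- is the factor `bands t` in the statement.
  have hl : (N.bands t : ℝ) * (Real.pi * N.reuseDensity t) = Real.pi * N.density t := by
    rw [Network.reuseDensity]
    field_simp
  rw [← mul_assoc (N.bands t : ℝ), hl]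
  congr 3
  -- The exponential law contributes `πλ_t x` and the farther points of tier `t` contribute `πλ_t x
  -- (Z^{(t,t)}/F_t - 1)`. The `-1` cancels, and `κ` supplies the remaining terms of `Z`.
  have hZ : Real.pi * N.reuseDensity t * N.tierZ N.reuseDensity t y
      = Real.pi * N.reuseDensity t * N.pairZ t t y + κ := by
    rw [Network.tierZ, Fintype.sum_eq_add_sum_subtype_ne _ t, mul_add, hκ, Finset.mul_sum]
    have hne := (hN.reuseDensity_pos t).ne'
    congr 1
    · field_simp
    · refine Finset.sum_congr rfl fun q _ => ?_
      field_simp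
  rw [hZ, ← hl]
  field_simp
  ring

end Deployment

/-! ### From the Laplace transform to the average rate -/

namespace Deployment

variable {T : ℕ} {N : Network T} {Ω : Type*} {D : Deployment N Ω}

/-- `exp (-y d ^ α (1 + I / σ²))`, where `d` is the distance of the serving base station and `I` the
aggregate interference. -/
noncomputable def attenuation (D : Deployment N Ω) (ch : (q : Fin T) → Fin (N.bands q)) (t : Fin T)
    (y : ℝ) (ω : Ω) : ℝ≥0∞ :=
  expNeg (ENNReal.ofReal (y * D.sqNearest t ω ^ (N.alpha / 2))
        + ENNReal.ofReal (y * D.sqNearest t ω ^ (N.alpha / 2) / N.noise)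
          * D.interference ch t ω)

lemma measurable_attenuation [MeasurableSpace Ω] (hpos : ∀ q b, Measurable (D.pos q b))
    (hgain : ∀ q b, Measurable (D.gain q b)) (hband : ∀ q b, Measurable (D.band q b))
    (ch : (q : Fin T) → Fin (N.bands q)) (t : Fin T) :
    Measurable fun z : Ω × ℝ => D.attenuation ch t z.2 z.1 := by
  have h1 : Measurable fun z : Ω × ℝ => D.sqNearest t z.1 :=
    (measurable_sqNearest hpos t).comp measurable_fst
  have h2 : Measurable fun z : Ω × ℝ => D.interference ch t z.1 :=
    (measurable_interference hpos hgain hband ch t).comp measurable_fst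
  unfold attenuation
  refine measurable_expNeg.comp ?_
  fun_prop

/-- The σ-algebra is arbitrary on purpose: besides the ambient one, it is taken to be generated by
all sources except the serving gain, which yields independence from that gain. -/
lemma measurable_indicator_attenuation {_ : MeasurableSpace Ω}
    (hpos : ∀ q b, Measurable (D.pos q b))
    (hgain : ∀ q b, Measurable (D.gain q b)) (hband : ∀ q b, Measurable (D.band q b))
    (ch : (q : Fin T) → Fin (N.bands q)) (t : Fin T) (y : ℝ) :
    Measurable ((D.assoc t).indicator (D.attenuation ch t y)) :=
  ((measurable_attenuation hpos hgain hband ch t).comp measurable_prodMk_right).indicator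
    (measurableSet_assoc hpos t)

lemma instRate_nonneg (D : Deployment N Ω) (ch : (q : Fin T) → Fin (N.bands q)) (t : Fin T)
    (ω : Ω) : 0 ≤ D.instRate ch t ω :=
  mul_nonneg (by positivity)
    (Real.log_nonneg (le_add_of_nonneg_right ENNReal.toReal_nonneg))

variable [mΩ : MeasurableSpace Ω] {μ : Measure Ω}

lemma IsModel.measurable_instRate (hD : D.IsModel μ)
    (ch : (q : Fin T) → Fin (N.bands q)) (t : Fin T) : Measurable (D.instRate ch t) := by
  have h1 := measurable_interference hD.measurable_pos hD.measurable_gain hD.measurable_band ch t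
  have h2 := measurable_nearest hD.measurable_pos t
  have h3 := hD.measurable_gain0 t
  unfold instRate sinr
  fun_prop

variable [IsProbabilityMeasure μ] {y : ℝ}

lemma IsModel.lintegral_indicator_attenuation (hD : D.IsModel μ) (hN : N.Admissible)
    (ch : (q : Fin T) → Fin (N.bands q)) (t : Fin T) (hy : 0 < y) :
    ∫⁻ ω, (D.assoc t).indicator (D.attenuation ch t y) ω ∂μ
      = ENNReal.ofReal (N.bands t) * ENNReal.ofReal (N.tierG N.reuseDensity t y) := by
  rw [← hD.lintegral_expNeg_mean hN t hy, ← hD.lintegral_expNeg_link hN ch t hy]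
  refine lintegral_congr_ae ?_
  filter_upwards [hD.ae_regular hN] with ω hω
  exact hω.indicator_mul_expNeg hN ch t hy

lemma IsModel.setLIntegral_attenuation (hD : D.IsModel μ) (hN : N.Admissible)
    (ch : (q : Fin T) → Fin (N.bands q)) (t : Fin T) (hy : 0 < y) :
    ∫⁻ ω in D.assoc t, ENNReal.ofReal ((1 - Real.exp (-(N.snr t * y * D.gain0 t ω))) / y)
        * D.attenuation ch t y ω ∂μ
      = ENNReal.ofReal (N.bands t) * ENNReal.ofReal (N.outerIntegrand N.reuseDensity t y) := by
  have hs : 0 ≤ N.snr t * y := (mul_pos (hN.snr_pos t) hy).le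
  have hA := measurableSet_assoc hD.measurable_pos t
  rw [← lintegral_indicator hA]
  simp_rw [indicator_mul_right]
  have hind := hD.indep.indepFun_of_disjoint hD.sigma_le (S := {Source.gain0 t})
    (S' := {Source.gain0 t}ᶜ) disjoint_compl_right
    (measurable_gain0_of_mem (mem_singleton _))
    (measurable_indicator_attenuation (D := D)
      (fun q b => measurable_pos_of_mem (by simp) b)
      (fun q b => measurable_gain_of_mem (by simp))
      (fun q b => measurable_band_of_mem (by simp)) ch t y)
  have hg := hD.measurable_gain0 t
  have hind' := hind.comp (φ := fun x : ℝ => ENNReal.ofReal ((1 - Real.exp (-(N.snr t * y * x))) / y))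
    (by fun_prop) measurable_id
  refine (lintegral_mul_eq_lintegral_mul_lintegral_of_indepFun'' (by fun_prop)
    (measurable_indicator_attenuation hD.measurable_pos hD.measurable_gain hD.measurable_band
      ch t y).aemeasurable hind').trans ?_
  rw [hD.lintegral_indicator_attenuation hN ch t hy]
  have h1 : ∫⁻ ω, ENNReal.ofReal ((1 - Real.exp (-(N.snr t * y * D.gain0 t ω))) / y) ∂μ
      = ENNReal.ofReal ((1 - fadingMGF (N.servLaw t) (N.snr t * y)) / y) := by
    rw [← lintegral_map (μ := μ)
      (f := fun x : ℝ => ENNReal.ofReal ((1 - Real.exp (-(N.snr t * y * x))) / y))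
      (by fun_prop) hg, hD.law_gain0]
    simp_rw [ENNReal.ofReal_div_of_pos hy, div_eq_mul_inv]
    rw [lintegral_mul_const _ (by fun_prop), (hN.servLaw_fading t).ofReal_one_sub_fadingMGF hs]
  have hM := (hN.servLaw_fading t).fadingMGF_le_one hs
  have hb := hN.one_le_bands_real t
  have h2 : 0 ≤ (1 - fadingMGF (N.servLaw t) (N.snr t * y)) / y :=
    div_nonneg (by linarith) hy.le
  simp only [Function.comp_apply]
  rw [h1, mul_left_comm, ← ENNReal.ofReal_mul h2, Network.outerIntegrand]
  congr 2
  ring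

lemma IsModel.lintegral_instRate (hD : D.IsModel μ) (hN : N.Admissible)
    (ch : (q : Fin T) → Fin (N.bands q)) (t : Fin T) :
    ∫⁻ ω in D.assoc t, ENNReal.ofReal (D.instRate ch t ω) ∂μ
      = ∫⁻ y in Ioi 0, ENNReal.ofReal (N.outerIntegrand N.reuseDensity t y) := by
  have hb := hN.one_le_bands_real t
  have hA := measurableSet_assoc hD.measurable_pos t
  have hg := hD.measurable_gain0 t
  have hatt := measurable_attenuation hD.measurable_pos hD.measurable_gain hD.measurable_band ch t
  have hm : Measurable fun z : Ω × ℝ =>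
      ENNReal.ofReal ((1 - Real.exp (-(N.snr t * z.2 * D.gain0 t z.1))) / z.2)
        * D.attenuation ch t z.2 z.1 := by
    have : Measurable fun z : Ω × ℝ => D.gain0 t z.1 := hg.comp measurable_fst
    exact Measurable.mul (by fun_prop) hatt
  have h1 : ∫⁻ ω in D.assoc t, ENNReal.ofReal (D.instRate ch t ω) ∂μ
      = ∫⁻ ω in D.assoc t, (ENNReal.ofReal (1 / N.bands t) * ∫⁻ y in Ioi (0 : ℝ),
        ENNReal.ofReal ((1 - Real.exp (-(N.snr t * y * D.gain0 t ω))) / y)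
        * D.attenuation ch t y ω) ∂μ := by
    refine lintegral_congr_ae (ae_restrict_of_ae ?_)
    filter_upwards [hD.ae_regular hN, hD.ae_gain0_nonneg hN t] with ω hω hω0
    rw [instRate, ENNReal.ofReal_mul (by positivity), hω.ofReal_log hN ch t hω0]
    rfl
  rw [h1, lintegral_const_mul' _ _ ENNReal.ofReal_ne_top, lintegral_lintegral_swap hm.aemeasurable,
    setLIntegral_congr_fun measurableSet_Ioi
      fun y hy => hD.setLIntegral_attenuation hN ch t (mem_Ioi.1 hy),
    lintegral_const_mul' _ _ ENNReal.ofReal_ne_top, ← mul_assoc,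
    ← ENNReal.ofReal_mul (by positivity), one_div_mul_cancel (by linarith), ENNReal.ofReal_one,
    one_mul]

/-- If the event were null, the attenuation integral at `y = 1` would vanish, whereas it equals `F_t
G(1)`, and `G(1)` is the integral of a positive function. -/
lemma IsModel.assoc_ne_zero (hD : D.IsModel μ) (hN : N.Admissible)
    (ch : (q : Fin T) → Fin (N.bands q)) (t : Fin T) : μ (D.assoc t) ≠ 0 := by
  intro h0
  have h := hD.lintegral_indicator_attenuation hN ch t one_pos
  rw [lintegral_indicator (measurableSet_assoc hD.measurable_pos t), Measure.restrict_eq_zero.2 h0,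
    lintegral_zero_measure, eq_comm, mul_eq_zero] at h
  have hb := hN.one_le_bands_real t
  have hG : 0 < N.tierG N.reuseDensity t 1 := by
    have hd := hN.decay_pos t one_pos
    rw [hN.tierG_eq t one_pos]
    refine mul_pos (mul_pos Real.pi_pos (hN.reuseDensity_pos t)) ?_
    have hi := integrableOn_exp_mul_exp_rpow (p := N.alpha / 2) hd one_pos
    rw [setIntegral_pos_iff_support_of_nonneg_ae
      (Eventually.of_forall fun ξ => by simp only [Pi.zero_apply]; positivity) hi]
    rw [inter_eq_self_of_subset_right fun ξ _ => by
      simp only [Function.mem_support]; positivity]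
    simp
  rcases h with h | h
  · rw [ENNReal.ofReal_eq_zero] at h
    linarith
  · rw [ENNReal.ofReal_eq_zero] at h
    linarith

lemma IsModel.integrableOn_instRate (hD : D.IsModel μ) (hN : N.Admissible)
    (ch : (q : Fin T) → Fin (N.bands q)) (t : Fin T) :
    IntegrableOn (D.instRate ch t) (D.assoc t) μ := by
  refine ⟨(hD.measurable_instRate ch t).aestronglyMeasurable, ?_⟩
  rw [hasFiniteIntegral_iff_ofReal (Eventually.of_forall fun ω => D.instRate_nonneg ch t ω),
    hD.lintegral_instRate hN ch t]
  exact (hasFiniteIntegral_iff_ofReal (by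
    filter_upwards [ae_restrict_mem measurableSet_Ioi] with y hy
    exact hN.outerIntegrand_nonneg t hy)).1 (hN.integrableOn_outerIntegrand t).2

end Deployment

/-! ### The rate formula -/

theorem corollary7 {T : ℕ} (N : Network T) (hN : N.Admissible)
    {Ω : Type*} [MeasurableSpace Ω] (μ : Measure Ω) [IsProbabilityMeasure μ]
    (D : Deployment N Ω) (hD : D.IsModel μ)
    (ch : (q : Fin T) → Fin (N.bands q)) (t : Fin T) :
    -- all the expressions are well defined
    (∀ q, ∀ y : ℝ, 0 < y → Summable (fadingTerm (N.interfLaw q) N.alpha y)) ∧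
    (∀ y : ℝ, 0 < y → 0 < N.tierZ N.reuseDensity t y) ∧
    (∀ y : ℝ, 0 < y → IntegrableOn (N.innerIntegrand N.reuseDensity t y) (Ioi 0)) ∧
    IntegrableOn (N.outerIntegrand N.reuseDensity t) (Ioi 0) ∧
    0 < D.assocProb μ t ∧
    Integrable (D.instRate ch t) (ProbabilityTheory.cond μ (D.assoc t)) ∧
    -- the average rate of the tier
    D.tierRate μ ch t = ∫ y in Ioi (0 : ℝ), N.outerIntegrand N.reuseDensity t y := by
  have hα := hN.two_lt_alpha
  have h0 := hD.assoc_ne_zero hN ch t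
  have hint := hD.integrableOn_instRate hN ch t
  have hprob : 0 < D.assocProb μ t := ENNReal.toReal_pos h0 (measure_ne_top _ _)
  refine ⟨fun q y hy => (hN.interfLaw_fading q).summable_fadingTerm hα hy,
    fun y hy => one_pos.trans_le (hN.one_le_tierZ t hy),
    fun y hy => integrableOn_rpow_mul_exp_mul_exp_rpow (hN.decay_pos t hy) hy (by linarith),
    hN.integrableOn_outerIntegrand t, hprob, hint.smul_measure (ENNReal.inv_ne_top.2 h0), ?_⟩
  -- Multiplying by the association probability cancels the normalisation of the conditional
  -- measure, leaving an integral over the event.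
  have hcond : D.tierRate μ ch t = ∫ ω in D.assoc t, D.instRate ch t ω ∂μ := by
    rw [Deployment.tierRate, Deployment.condRate, ProbabilityTheory.cond, integral_smul_measure,
      ENNReal.toReal_inv, smul_eq_mul]
    exact mul_inv_cancel_left₀ hprob.ne' _
  rw [hcond, integral_eq_lintegral_of_nonneg_ae
    (Eventually.of_forall fun ω => D.instRate_nonneg ch t ω) hint.1,
    hD.lintegral_instRate hN ch t, ← integral_eq_lintegral_of_nonneg_ae _
      (hN.integrableOn_outerIntegrand t).1]
  filter_upwards [ae_restrict_mem measurableSet_Ioi] with y hy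
  exact hN.outerIntegrand_nonneg t hy
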